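/- Let $E$ be a finite set of items, $O$ a set of states, and $p$ a (discrete) probability distribution on realizations $\phi:E\to O$; let $\Phi\sim p$. Let $f:2^E\times O^E\to\mathbb{R}_{\ge 0}$ be a utility function with $\mathbb{E}[f(S,\Phi)]<\infty$ for every $S\subseteq E$. A partial realization is a map $\psi:\mathrm{dom}(\psi)\to O$ with $\mathrm{dom}(\psi)\subseteq E$; write $\psi\prec\phi$ if $\phi$ extends $\psi$, and $\psi\subseteq\psi'$ if $\psi'$ extends $\psi$. For $e\in E$ and $\psi$ with $\Pr[\psi\prec\Phi]>0$ let $$\Delta(e\mid\psi)=\mathbb{E}\big[f(\mathrm{dom}(\psi)\cup\{e\},\Phi)-f(\mathrm{dom}(\psi),\Phi)\,\big|\,\psi\prec\Phi\big].$$ Assume that $f$ is adaptive submodular with respect to $p$: $\Delta(e\mid\psi)\ge\Delta(e\mid\psi')$ whenever $\psi\subseteq\psi'$, $\Pr[\psi'\prec\Phi]>0$ and $e\notin\mathrm{dom}(\psi')$. (Pointwise submodularity and monotonicity are not assumed.) Let $k\ge 1$ be an integer and let $(E,\mathcal{I})$ be a $k$-system: $\emptyset\in\mathcal{I}$, $\mathcal{I}$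 is closed under taking subsets, and for every $R\subseteq E$ any two inclusion-maximal independent subsets $B,B'$ of $R$ satisfy $|B|\le k|B'|$. An adaptive (possibly randomized) policy $\pi$ repeatedly either stops or selects an item not selected before, depending only on the states of the items selected so far and on its own randomness, which is independent of $\Phi$; selecting $e$ reveals $\Phi(e)$. Let $E(\pi,\phi)$ be the random set of items that $\pi$ selects under the realization $\phi$, and let $f_{avg}(\pi)=\mathbb{E}[f(E(\pi,\Phi),\Phi)]$. The policy $\pi$ is feasible if $E(\pi,\phi)\in\mathcal{I}$ (surely) for every $\phi$ with $p(\phi)>0$. For $\delta_0,\delta_1\in[0,1]$, the sampling-based adaptive greedy policy $\pi^{sag}$ is the following. Draw a random set $S_1\subseteq E$ containing each item independently with probability $\delta_0$ and put $S_2=E\setminus S_1$. Independently, let $S=S_1$ with probability $\delta_1$ and $S=S_2$ with probability $1-\delta_1$. Starting from $\psi=\emptyset$, as long as the set $$F=\{e\in S\setminus\mathrm{dom}(\psi)\;:\;\mathrm{dom}(\psi)\cup\{e\}\in\mathcal{I},\ \Delta(e\mid\psi)>0\}$$ is non-empty, select an item $e\in\arg\max_{e\in F}\Delta(e\mid\psi)$,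 observe $\Phi(e)$ and add $(e,\Phi(e))$ to $\psi$; stop when $F$ is empty. Ties in the $\arg\max$ are broken by an arbitrary fixed priority order on $E$, which may depend on $\psi$. Then, for $\delta_1=\delta_0=\frac12$, the policy $\pi^{sag}$ is feasible, and for every feasible policy $\pi$ (in particular for an optimal feasible policy $\pi^{opt}$) $$f_{avg}(\pi^{sag})\ \ge\ \frac{1}{2k+4}\,f_{avg}(\pi).$$ -/

import Mathlib

open scoped NNReal ENNReal

noncomputable section

namespace AdaptiveSubmodular

universe u v

variable {E : Type u} {O : Type v}

/-- A partial realization: `ψ e = some o` if the state `o` of item `e` has been observed, and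
`ψ e = none` if `e` is outside the domain. -/
abbrev PartialRealization (E : Type u) (O : Type v) := E → Option O

/-- The domain of a partial realization. -/
def dom [Fintype E] (ψ : PartialRealization E O) : Finset E :=
  Finset.univ.filter fun e => (ψ e).isSome

/-- `ψ ≺ φ`: the partial realization `ψ` agrees with `φ` on the domain of `ψ`. -/
def Consistent (ψ : PartialRealization E O) (φ : E → O) : Prop :=
  ∀ e o, ψ e = some o → φ e = o

/-- `ψ ⊆ ψ'`: `ψ` is a subrealization of `ψ'`. -/
def Subrealization (ψ ψ' : PartialRealization E O) : Prop :=
  ∀ e o, ψ e = some o → ψ' e = some o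

/-- `Pr[ψ ≺ Φ]` for `Φ ∼ p`. -/
def probConsistent (p : PMF (E → O)) (ψ : PartialRealization E O) : ℝ :=
  ∑' φ, {φ | Consistent ψ φ}.indicator (fun φ => (p φ).toReal) φ

/-- The conditional expected marginal utility `Δ(e ∣ ψ)`, meaningful if `Pr[ψ ≺ Φ] > 0`. -/
def marginal [Fintype E] [DecidableEq E] (p : PMF (E → O)) (f : Finset E → (E → O) → ℝ)
    (e : E) (ψ : PartialRealization E O) : ℝ :=
  (∑' φ, {φ | Consistent ψ φ}.indicator
    (fun φ => (p φ).toReal * (f (insert e (dom ψ)) φ - f (dom ψ) φ)) φ) / probConsistent p ψ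

/-- Adaptive submodularity of `f` with respect to the prior `p`. The conditional expectations
exist exactly for partial realizations of positive probability. -/
def IsAdaptiveSubmodular [Fintype E] [DecidableEq E] (p : PMF (E → O))
    (f : Finset E → (E → O) → ℝ) : Prop :=
  ∀ ψ ψ' : PartialRealization E O, Subrealization ψ ψ' → 0 < probConsistent p ψ' →
    ∀ e, e ∉ dom ψ' → marginal p f e ψ' ≤ marginal p f e ψ

/-- `(E, I)` is an independence system. -/
def IsIndependenceSystem (I : Set (Finset E)) : Prop :=
  ∅ ∈ I ∧ ∀ A ∈ I, ∀ B, B ⊆ A → B ∈ I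

/-- `B` is a base of `R`: an inclusion-maximal independent subset of `R`. -/
def IsBaseOf (I : Set (Finset E)) (R B : Finset E) : Prop :=
  (B ∈ I ∧ B ⊆ R) ∧ ∀ A ∈ I, A ⊆ R → B ⊆ A → B = A

/-- `(E, I)` is a `k`-system: any two bases of the same set have sizes within a factor `k`. -/
def IsKSystem (I : Set (Finset E)) (k : ℕ) : Prop :=
  IsIndependenceSystem I ∧ 1 ≤ k ∧
    ∀ R B B' : Finset E, IsBaseOf I R B → IsBaseOf I R B' → B.card ≤ k * B'.card

/-- An adaptive policy: a map from observations to distributions of the next action, which is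
either `some e` (select the new item `e`) or `none` (stop). -/
structure Policy (E : Type u) (O : Type v) where
  next : PartialRealization E O → PMF (Option E)
  fresh : ∀ ψ e, some e ∈ (next ψ).support → ψ e = none

/-- The observation after `n` further steps of `π` from the observation `ψ`, under the
realization `φ`. -/
def Policy.run [DecidableEq E] (π : Policy E O) (φ : E → O) :
    ℕ → PartialRealization E O → PMF (PartialRealization E O)
  | 0, ψ => PMF.pure ψ
  | n + 1, ψ => (π.next ψ).bind fun a =>
      match a with
      | none => PMF.pure ψ
      | some e => π.run φ n (Function.update ψ e (some (φ e)))

/-- The law of the set `E(π, φ)` of items selected by `π` under `φ`. Since a policy selects new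
items only, it has stopped after at most `|E|` steps. -/
def Policy.selected [Fintype E] [DecidableEq E] (π : Policy E O) (φ : E → O) :
    PMF (Finset E) :=
  (π.run φ (Fintype.card E) fun _ => none).map dom

/-- A randomized policy: a policy drawn at random before the first selection (the policy drawn
may randomize further along its run). -/
abbrev RandomizedPolicy (E : Type u) (O : Type v) := PMF (Policy E O)

/-- The law of the set `E(π, φ)` for a randomized policy. -/
def selected [Fintype E] [DecidableEq E] (π : RandomizedPolicy E O) (φ : E → O) :
    PMF (Finset E) :=
  π.bind fun π' => π'.selected φ

/-- The expected utility `f_avg(π)`, over `Φ ∼ p` and the internal randomness of `π`. -/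
def favg [Fintype E] [DecidableEq E] (p : PMF (E → O)) (f : Finset E → (E → O) → ℝ)
    (π : RandomizedPolicy E O) : ℝ :=
  ∑' φ, (p φ).toReal * ∑ S : Finset E, (selected π φ S).toReal * f S φ

/-- `π ∈ Ω`: under every realization of positive probability, the set selected by `π` is
(surely) independent. -/
def Feasible [Fintype E] [DecidableEq E] (p : PMF (E → O)) (I : Set (Finset E))
    (π : RandomizedPolicy E O) : Prop :=
  ∀ φ ∈ p.support, ∀ S ∈ (selected π φ).support, S ∈ I

open scoped Classical in
/-- The candidates of the greedy rule at the observation `ψ`: the items of `S` not yet selected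
that keep the selection independent and have positive conditional expected marginal utility. -/
def candidates [Fintype E] [DecidableEq E] (p : PMF (E → O)) (f : Finset E → (E → O) → ℝ)
    (I : Set (Finset E)) (S : Finset E) (ψ : PartialRealization E O) : Finset E :=
  S.filter fun e => ψ e = none ∧ insert e (dom ψ) ∈ I ∧ 0 < marginal p f e ψ

/-- `e` is the element of `F` of largest marginal utility at `ψ`, ties being resolved in favour
of the smallest label. -/
def IsGreedyChoice [Fintype E] [DecidableEq E] (p : PMF (E → O)) (f : Finset E → (E → O) → ℝ)
    (label : E ↪ ℕ) (F : Finset E) (ψ : PartialRealization E O) (e : E) : Prop :=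
  e ∈ F ∧ (∀ e' ∈ F, marginal p f e' ψ ≤ marginal p f e ψ) ∧
    ∀ e' ∈ F, marginal p f e' ψ = marginal p f e ψ → label e ≤ label e'

theorem exists_isGreedyChoice [Fintype E] [DecidableEq E] (p : PMF (E → O))
    (f : Finset E → (E → O) → ℝ) (label : E ↪ ℕ) (F : Finset E)
    (ψ : PartialRealization E O) (hF : F.Nonempty) :
    ∃ e, IsGreedyChoice p f label F ψ e := by
  classical
  obtain ⟨m, hm, hmax⟩ := F.exists_max_image (fun e => marginal p f e ψ) hF
  obtain ⟨e, he, hmin⟩ :=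
    (F.filter fun e => marginal p f e ψ = marginal p f m ψ).exists_min_image label
      ⟨m, by simp [hm]⟩
  rw [Finset.mem_filter] at he
  refine ⟨e, he.1, fun e' h' => (hmax e' h').trans he.2.ge, fun e' h' heq => hmin e' ?_⟩
  rw [Finset.mem_filter]
  exact ⟨h', heq.trans he.2⟩

open scoped Classical in
/-- The next action of the greedy rule restricted to `S`. -/
def greedyStep [Fintype E] [DecidableEq E] (p : PMF (E → O)) (f : Finset E → (E → O) → ℝ)
    (I : Set (Finset E)) (tie : PartialRealization E O → (E ↪ ℕ)) (S : Finset E)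
    (ψ : PartialRealization E O) : Option E :=
  if h : (candidates p f I S ψ).Nonempty then
    some (exists_isGreedyChoice p f (tie ψ) _ ψ h).choose
  else none

theorem greedyStep_fresh [Fintype E] [DecidableEq E] (p : PMF (E → O))
    (f : Finset E → (E → O) → ℝ) (I : Set (Finset E))
    (tie : PartialRealization E O → (E ↪ ℕ)) (S : Finset E) (ψ : PartialRealization E O) (e : E)
    (h : greedyStep p f I tie S ψ = some e) : ψ e = none := by
  unfold greedyStep at h
  split_ifs at h with hne
  have hc := (exists_isGreedyChoice p f (tie ψ) _ ψ hne).choose_spec.1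
  rw [Option.some.inj h] at hc
  simp only [candidates, Finset.mem_filter] at hc
  exact hc.2.1

/-- The adaptive greedy policy that selects items from `S` only. -/
def greedyPolicy [Fintype E] [DecidableEq E] (p : PMF (E → O)) (f : Finset E → (E → O) → ℝ)
    (I : Set (Finset E)) (tie : PartialRealization E O → (E ↪ ℕ)) (S : Finset E) :
    Policy E O where
  next ψ := PMF.pure (greedyStep p f I tie S ψ)
  fresh ψ e h := greedyStep_fresh p f I tie S ψ e (by simpa using Eq.symm (by simpa using h))

/-- A coin showing `true` with probability `δ`. -/
def coin (δ : ℝ≥0) (hδ : δ ≤ 1) : PMF Bool :=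
  PMF.ofFintype (fun b => ((if b then δ else 1 - δ : ℝ≥0) : ℝ≥0∞)) (by
    rw [Fintype.sum_bool, ← ENNReal.coe_add]
    simp [add_tsub_cancel_of_le hδ])

/-- The random subset of `E` containing each item independently with probability `δ`. -/
def randomSubset (E : Type u) [Fintype E] (δ : ℝ≥0) (hδ : δ ≤ 1) : PMF (Finset E) :=
  PMF.ofFintype
    (fun S => ((δ ^ S.card * (1 - δ) ^ (Fintype.card E - S.card) : ℝ≥0) : ℝ≥0∞)) (by
    rw [← ENNReal.ofNNReal_finsetSum, Fintype.sum_pow_mul_eq_add_pow, add_tsub_cancel_of_le hδ]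
    simp)

/-- The sampling-based adaptive greedy policy `π^sag`: with probability `δ₁` run the greedy policy
on the random set `S₁`, and otherwise on its complement `S₂ = E \ S₁`, where `S₁` contains each
item independently with probability `δ₀`. -/
def sag [Fintype E] [DecidableEq E] (p : PMF (E → O)) (f : Finset E → (E → O) → ℝ)
    (I : Set (Finset E)) (tie : PartialRealization E O → (E ↪ ℕ))
    (δ₀ δ₁ : ℝ≥0) (h₀ : δ₀ ≤ 1) (h₁ : δ₁ ≤ 1) : RandomizedPolicy E O :=
  (coin δ₁ h₁).bind fun b => (randomSubset E δ₀ h₀).bind fun S₁ =>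
    PMF.pure (greedyPolicy p f I tie (if b then S₁ else S₁ᶜ))

end AdaptiveSubmodular

end

/-! Let `n` be the number of items, write `A_S` for the greedy selection on a fixed set `S`, and let
`T` be the selection of a competing policy `π`, run on the same realization. For `δ₀ = δ₁ = 1/2` the
sampled set is uniform over all subsets, so the value of the sampling policy is `2^{-n} ∑_S E
f(A_S)` (`favg_sag_half`). A randomized competitor is a mixture of policies, so it suffices to bound
each one in its support (`favg_le_of_forall_support`). The constant comes from bounding `∑_S E f(T ∪
A_S)` from both sides.

From below: `A_S` and `A_{Sᶜ}` are disjoint, and by adaptive submodularity `A_{Sᶜ}` adds in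
expectation no more to `T ∪ A_S` than to `T`. Since `f ≥ 0`, this gives `E f(T) ≤ E f(T ∪ A_S) + E
f(T ∪ A_{Sᶜ})` (`Policy.expect_le_union_add_union`). Summing over `S` yields `2^n E f(T) ≤ 2 ∑_S E
f(T ∪ A_S)`. This replaces monotonicity.

From above: `E f(T ∪ A_S)` exceeds `E f(A_S)` by at most the expected sum of the marginals, given
the states on `A_S`, of the items in `T \ A_S` (`Policy.expect_union_le`). These marginals are
bounded pointwise (`sum_marginal_le`). An item that greedy would have selected had it been added to
`S` is charged to its own gain in that enlarged run. Any other item of positive marginal eventually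
became infeasible, and the `k`-system property allows charging all of these to at most `k` times the
greedy gain. Over all `S`, the first kind of charge sums to exactly the total greedy gain, by
matching `(S, e)` with `(S ∪ {e}, e)` (`sum_compl_itemGain`). As the expected greedy gain is at most
`E f(A_S)`, the upper bound is `(k + 2) ∑_S E f(A_S)`, and the two bounds combine to the factor `2k
+ 4`.

All probabilistic steps rest on one device: a bounded weight depending only on the states in `D` may
be pulled through conditional expectation given `D` (`expect_mul_condExpect`). The weights are
probabilities of histories of the policies. -/

noncomputable section

namespace AdaptiveSubmodular

universe u v

variable {E : Type u} {O : Type v}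

/-! ### Expectations over realizations -/

/-- The expectation of `h(Φ)` for `Φ ∼ p`. -/
def expect (p : PMF (E → O)) (h : (E → O) → ℝ) : ℝ := ∑' φ, (p φ).toReal * h φ

/-- `h(Φ)` has a finite expectation. -/
def HasExpect (p : PMF (E → O)) (h : (E → O) → ℝ) : Prop :=
  Summable fun φ => (p φ).toReal * h φ

theorem summable_toReal (p : PMF (E → O)) : Summable fun φ => (p φ).toReal :=
  ENNReal.summable_toReal p.tsum_coe_ne_top

theorem HasExpect.add {p : PMF (E → O)} {g h : (E → O) → ℝ} (hg : HasExpect p g)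
    (hh : HasExpect p h) : HasExpect p fun φ => g φ + h φ := by
  simpa [HasExpect, mul_add] using Summable.add hg hh

theorem HasExpect.sub {p : PMF (E → O)} {g h : (E → O) → ℝ} (hg : HasExpect p g)
    (hh : HasExpect p h) : HasExpect p fun φ => g φ - h φ := by
  simpa [HasExpect, mul_sub] using Summable.sub hg hh

theorem HasExpect.sum {ι : Type*} {p : PMF (E → O)} {s : Finset ι} {g : ι → (E → O) → ℝ}
    (hg : ∀ i ∈ s, HasExpect p (g i)) : HasExpect p fun φ => ∑ i ∈ s, g i φ := by
  simpa [HasExpect, Finset.mul_sum] using summable_sum hg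

theorem HasExpect.const_mul {p : PMF (E → O)} {g : (E → O) → ℝ} (hg : HasExpect p g) (c : ℝ) :
    HasExpect p fun φ => c * g φ := by
  simpa [HasExpect, mul_left_comm] using Summable.mul_left c hg

theorem HasExpect.bdd_mul {p : PMF (E → O)} {g h : (E → O) → ℝ} (hg : HasExpect p g)
    (hh : ∀ φ, |h φ| ≤ 1) : HasExpect p fun φ => h φ * g φ := by
  refine Summable.of_norm_bounded (Summable.abs hg) fun φ => ?_
  rw [Real.norm_eq_abs, mul_left_comm, abs_mul]
  exact mul_le_of_le_one_left (abs_nonneg _) (hh φ)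

theorem expect_add {p : PMF (E → O)} {g h : (E → O) → ℝ} (hg : HasExpect p g)
    (hh : HasExpect p h) : expect p (fun φ => g φ + h φ) = expect p g + expect p h := by
  simpa [expect, mul_add] using Summable.tsum_add hg hh

theorem expect_sub {p : PMF (E → O)} {g h : (E → O) → ℝ} (hg : HasExpect p g)
    (hh : HasExpect p h) : expect p (fun φ => g φ - h φ) = expect p g - expect p h := by
  simpa [expect, mul_sub] using Summable.tsum_sub hg hh

theorem expect_sum {ι : Type*} {p : PMF (E → O)} {s : Finset ι} {g : ι → (E → O) → ℝ}
    (hg : ∀ i ∈ s, HasExpect p (g i)) :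
    expect p (fun φ => ∑ i ∈ s, g i φ) = ∑ i ∈ s, expect p (g i) := by
  simpa [expect, Finset.mul_sum] using Summable.tsum_finsetSum hg

theorem expect_const_mul {p : PMF (E → O)} {g : (E → O) → ℝ} (c : ℝ) :
    expect p (fun φ => c * g φ) = c * expect p g := by
  simp [expect, mul_left_comm, tsum_mul_left]

theorem expect_mono {p : PMF (E → O)} {g h : (E → O) → ℝ} (hg : HasExpect p g)
    (hh : HasExpect p h) (hle : ∀ φ ∈ p.support, g φ ≤ h φ) : expect p g ≤ expect p h := by
  refine Summable.tsum_le_tsum (fun φ => ?_) hg hh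
  by_cases hφ : p φ = 0
  · simp [hφ]
  · exact mul_le_mul_of_nonneg_left (hle φ hφ) ENNReal.toReal_nonneg

theorem expect_nonneg {p : PMF (E → O)} {g : (E → O) → ℝ} (hg : ∀ φ, 0 ≤ g φ) :
    0 ≤ expect p g :=
  tsum_nonneg fun φ => mul_nonneg ENNReal.toReal_nonneg (hg φ)

/-! ### Restrictions of realizations and local functions -/

/-- The partial realization that reveals `φ` on `D`. -/
def restrict [DecidableEq E] (φ : E → O) (D : Finset E) : PartialRealization E O :=
  fun e => if e ∈ D then some (φ e) else none

/-- `h φ` depends only on the states of the items in `D`. -/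
def LocalOn {α : Type*} (D : Finset E) (h : (E → O) → α) : Prop :=
  ∀ φ φ' : E → O, (∀ e ∈ D, φ e = φ' e) → h φ = h φ'

theorem LocalOn.mono {α : Type*} {D D' : Finset E} {h : (E → O) → α} (hh : LocalOn D h)
    (hD : D ⊆ D') : LocalOn D' h :=
  fun φ φ' hφ => hh φ φ' fun e he => hφ e (hD he)

theorem LocalOn.mul {D : Finset E} {g h : (E → O) → ℝ} (hg : LocalOn D g)
    (hh : LocalOn D h) : LocalOn D fun φ => g φ * h φ :=
  fun φ φ' hφ => by simp only [hg φ φ' hφ, hh φ φ' hφ]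

theorem abs_mul_le_one {a b : ℝ} (ha : |a| ≤ 1) (hb : |b| ≤ 1) : |a * b| ≤ 1 := by
  rw [abs_mul]; exact mul_le_one₀ ha (abs_nonneg _) hb

theorem summable_consistent (p : PMF (E → O)) (ψ : PartialRealization E O) :
    Summable fun φ => {φ | Consistent ψ φ}.indicator (fun φ => (p φ).toReal) φ :=
  (summable_toReal p).indicator _

theorem probConsistent_nonneg (p : PMF (E → O)) (ψ : PartialRealization E O) :
    0 ≤ probConsistent p ψ :=
  tsum_nonneg fun _ => Set.indicator_nonneg (fun _ _ => ENNReal.toReal_nonneg) _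

section Restrict

variable [DecidableEq E]

@[simp]
theorem restrict_empty (φ : E → O) : restrict φ ∅ = fun _ => none := by
  funext e; simp [restrict]

theorem restrict_eq_none {φ : E → O} {D : Finset E} {e : E} :
    restrict φ D e = none ↔ e ∉ D := by
  simp [restrict]

@[simp]
theorem dom_restrict [Fintype E] (φ : E → O) (D : Finset E) : dom (restrict φ D) = D := by
  ext e; by_cases h : e ∈ D <;> simp [dom, restrict, h]

theorem update_restrict (φ : E → O) (D : Finset E) (e : E) :
    Function.update (restrict φ D) e (some (φ e)) = restrict φ (insert e D) := by
  funext a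
  by_cases h : a = e
  · subst h; simp [restrict]
  · simp [restrict, h]

theorem restrict_congr {φ φ' : E → O} {D : Finset E} (h : ∀ e ∈ D, φ e = φ' e) :
    restrict φ D = restrict φ' D := by
  funext e; by_cases he : e ∈ D <;> simp [restrict, he, h]

theorem consistent_restrict {φ φ' : E → O} {D : Finset E} :
    Consistent (restrict φ D) φ' ↔ ∀ e ∈ D, φ e = φ' e := by
  refine ⟨fun h e he => (h e (φ e) (by simp [restrict, he])).symm, fun h e o ho => ?_⟩
  by_cases he : e ∈ D
  · simp only [restrict, he, if_true, Option.some.injEq] at ho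
    rw [← ho, h e he]
  · simp [restrict, he] at ho

theorem subrealization_restrict {φ : E → O} {D D' : Finset E} (h : D ⊆ D') :
    Subrealization (restrict φ D) (restrict φ D') := by
  intro e o ho
  by_cases he : e ∈ D
  · simpa [restrict, he, h he] using ho
  · simp [restrict, he] at ho

theorem toReal_le_probConsistent (p : PMF (E → O)) (φ : E → O) (D : Finset E) :
    (p φ).toReal ≤ probConsistent p (restrict φ D) := by
  have h := (summable_consistent p (restrict φ D)).le_tsum φ
    fun φ' _ => Set.indicator_nonneg (fun _ _ => ENNReal.toReal_nonneg) _
  rwa [Set.indicator_of_mem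
    (show φ ∈ {φ' | Consistent (restrict φ D) φ'} from consistent_restrict.2 fun _ _ => rfl)] at h

theorem probConsistent_restrict_pos {p : PMF (E → O)} {φ : E → O} (hφ : φ ∈ p.support)
    (D : Finset E) : 0 < probConsistent p (restrict φ D) :=
  (ENNReal.toReal_pos hφ (p.apply_ne_top φ)).trans_le (toReal_le_probConsistent p φ D)

/-! ### Conditional expectations given the states of finitely many items -/

/-- The conditional expectation of `F` given the states of the items in `D`. -/
def condExpect (p : PMF (E → O)) (D : Finset E) (F : (E → O) → ℝ) (φ : E → O) : ℝ :=
  (∑' φ', {φ' | Consistent (restrict φ D) φ'}.indicator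
    (fun φ' => (p φ').toReal * F φ') φ') / probConsistent p (restrict φ D)

/-- The joint law of two realizations that are conditionally independent given their common
states on `D`. -/
def couple (p : PMF (E → O)) (D : Finset E) (φ φ' : E → O) : ℝ :=
  {φ' | Consistent (restrict φ D) φ'}.indicator
    (fun φ' => (p φ).toReal * (p φ').toReal / probConsistent p (restrict φ D)) φ'

theorem couple_nonneg (p : PMF (E → O)) (D : Finset E) (φ φ' : E → O) :
    0 ≤ couple p D φ φ' :=
  Set.indicator_nonneg (fun _ _ => div_nonneg
    (mul_nonneg ENNReal.toReal_nonneg ENNReal.toReal_nonneg) (probConsistent_nonneg p _)) _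

/-- The coupling is symmetric: where it is non-zero, both realizations restrict to the same partial
realization, so the normalizer may be read off from either one. -/
theorem couple_eq (p : PMF (E → O)) (D : Finset E) (φ φ' : E → O) :
    couple p D φ φ' = (p φ').toReal / probConsistent p (restrict φ' D) *
      {φ | Consistent (restrict φ' D) φ}.indicator (fun φ => (p φ).toReal) φ := by
  by_cases h : ∀ e ∈ D, φ e = φ' e
  · have h' : ∀ e ∈ D, φ' e = φ e := fun e he => (h e he).symm
    rw [couple, Set.indicator_of_mem (show φ' ∈ _ from consistent_restrict.2 h),
      Set.indicator_of_mem (show φ ∈ _ from consistent_restrict.2 h'), restrict_congr h]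
    ring
  · have h' : ¬ ∀ e ∈ D, φ' e = φ e := fun h' => h fun e he => (h' e he).symm
    rw [couple, Set.indicator_of_notMem (fun hm => h (consistent_restrict.1 hm)),
      Set.indicator_of_notMem (fun hm => h' (consistent_restrict.1 hm)), mul_zero]

theorem tsum_couple (p : PMF (E → O)) (D : Finset E) (φ' : E → O) :
    ∑' φ, couple p D φ φ' = (p φ').toReal := by
  simp_rw [couple_eq]
  rw [tsum_mul_left]
  change (p φ').toReal / _ * probConsistent p (restrict φ' D) = _
  -- The normalizer can vanish only here, and then both sides are zero.
  by_cases h : p φ' = 0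
  · simp [h]
  · exact div_mul_cancel₀ _ (probConsistent_restrict_pos h D).ne'

theorem summable_couple (p : PMF (E → O)) (D : Finset E) (φ' : E → O) :
    Summable fun φ => couple p D φ φ' := by
  simp_rw [couple_eq]
  exact (summable_consistent p _).mul_left _

/-- Licenses the exchange of sums in the tower property. The argument of `F` is the first
coordinate, so that the inner sum of the dominating series is a marginal of the coupling. -/
theorem summable_couple_mul {p : PMF (E → O)} {F : (E → O) → ℝ} (hF : HasExpect p F)
    (D : Finset E) {h : (E → O) → ℝ} (hb : ∀ φ, |h φ| ≤ 1) :
    Summable fun x : (E → O) × (E → O) => couple p D x.2 x.1 * (h x.2 * F x.1) := by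
  have key : Summable fun x : (E → O) × (E → O) => couple p D x.2 x.1 * |F x.1| := by
    have h0 : 0 ≤ fun x : (E → O) × (E → O) => couple p D x.2 x.1 * |F x.1| :=
      fun x => mul_nonneg (couple_nonneg p D x.2 x.1) (abs_nonneg (F x.1))
    refine (summable_prod_of_nonneg h0).2
      ⟨fun φ' => (summable_couple p D φ').mul_right |F φ'|, ?_⟩
    simp only [tsum_mul_right, tsum_couple]
    refine (Summable.abs hF).congr fun φ => ?_
    rw [abs_mul, abs_of_nonneg ENNReal.toReal_nonneg]
  refine Summable.of_norm_bounded key fun x => ?_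
  rw [Real.norm_eq_abs, abs_mul, abs_mul, abs_of_nonneg (couple_nonneg _ _ _ _)]
  exact mul_le_mul_of_nonneg_left (mul_le_of_le_one_left (abs_nonneg _) (hb _))
    (couple_nonneg _ _ _ _)

/-- With the conditional expectation written as a sum against the coupling, the tower property is an
exchange of two sums. -/
theorem mul_condExpect_eq_tsum (p : PMF (E → O)) (D : Finset E) (F h : (E → O) → ℝ)
    (φ : E → O) :
    (p φ).toReal * (h φ * condExpect p D F φ) = ∑' φ', couple p D φ φ' * (h φ * F φ') := by
  have : ∀ φ', couple p D φ φ' * (h φ * F φ') =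
      ((p φ).toReal * h φ / probConsistent p (restrict φ D)) *
        {φ' | Consistent (restrict φ D) φ'}.indicator (fun φ' => (p φ').toReal * F φ') φ' := by
    intro φ'
    by_cases hm : φ' ∈ {φ' | Consistent (restrict φ D) φ'}
    · rw [couple, Set.indicator_of_mem hm, Set.indicator_of_mem hm]; ring
    · rw [couple, Set.indicator_of_notMem hm, Set.indicator_of_notMem hm]; ring
  simp_rw [this, tsum_mul_left, condExpect]
  ring

theorem HasExpect.condExpect {p : PMF (E → O)} {F : (E → O) → ℝ} (hF : HasExpect p F)
    (D : Finset E) : HasExpect p (condExpect p D F) := by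
  have h := (summable_couple_mul hF D (h := fun _ => 1) (by simp)).prod_symm.prod
  refine h.congr fun φ => ?_
  have := mul_condExpect_eq_tsum p D F (fun _ => 1) φ
  simpa using this.symm

/-- The tower property. -/
theorem expect_mul_condExpect {p : PMF (E → O)} {F : (E → O) → ℝ} (hF : HasExpect p F)
    {D : Finset E} {h : (E → O) → ℝ} (hb : ∀ φ, |h φ| ≤ 1) (hD : LocalOn D h) :
    expect p (fun φ => h φ * condExpect p D F φ) = expect p (fun φ => h φ * F φ) := by
  have hs := summable_couple_mul hF D hb
  simp only [expect, mul_condExpect_eq_tsum]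
  rw [Summable.tsum_comm (f := fun φ' φ => couple p D φ φ' * (h φ * F φ')) hs]
  refine tsum_congr fun φ' => ?_
  have : ∀ φ, couple p D φ φ' * (h φ * F φ') = couple p D φ φ' * (h φ' * F φ') := by
    intro φ
    by_cases hm : ∀ e ∈ D, φ e = φ' e
    · rw [hD φ φ' hm]
    · rw [couple, Set.indicator_of_notMem (fun h' => hm (consistent_restrict.1 h'))]; simp
  simp_rw [this, tsum_mul_right, tsum_couple]

/-! ### Marginals -/

variable [Fintype E]

theorem marginal_restrict (p : PMF (E → O)) (f : Finset E → (E → O) → ℝ) (e : E)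
    (D : Finset E) (φ : E → O) :
    marginal p f e (restrict φ D) =
      condExpect p D (fun φ => f (insert e D) φ - f D φ) φ := by
  simp only [marginal, condExpect, dom_restrict]

theorem hasExpect_marginal {p : PMF (E → O)} {f : Finset E → (E → O) → ℝ}
    (hf : ∀ S, HasExpect p (f S)) (e : E) (D : Finset E) :
    HasExpect p fun φ => marginal p f e (restrict φ D) := by
  simp_rw [marginal_restrict]
  exact ((hf _).sub (hf _)).condExpect D

theorem expect_mul_marginal {p : PMF (E → O)} {f : Finset E → (E → O) → ℝ}
    (hf : ∀ S, HasExpect p (f S)) (e : E) {D : Finset E} {h : (E → O) → ℝ}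
    (hb : ∀ φ, |h φ| ≤ 1) (hD : LocalOn D h) :
    expect p (fun φ => h φ * marginal p f e (restrict φ D)) =
      expect p (fun φ => h φ * (f (insert e D) φ - f D φ)) := by
  simp_rw [marginal_restrict]
  exact expect_mul_condExpect ((hf _).sub (hf _)) hb hD

/-- Adaptive submodularity along a single realization; the positive-probability condition is
automatic on the support of `p`. -/
theorem marginal_restrict_anti {p : PMF (E → O)} {f : Finset E → (E → O) → ℝ}
    (hs : IsAdaptiveSubmodular p f) {φ : E → O} (hφ : φ ∈ p.support) {D D' : Finset E}
    (hD : D ⊆ D') {e : E} (he : e ∉ D') :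
    marginal p f e (restrict φ D') ≤ marginal p f e (restrict φ D) :=
  hs _ _ (subrealization_restrict hD) (probConsistent_restrict_pos hφ D') e (by simpa using he)

/-- The expected gain of `e` on top of `D'` is at most its conditional expected marginal utility
on top of a subset `D`, when weighted by any function of the states on `D'`. -/
theorem expect_mul_gain_le {p : PMF (E → O)} {f : Finset E → (E → O) → ℝ}
    (hf : ∀ S, HasExpect p (f S)) (hs : IsAdaptiveSubmodular p f) {e : E} {D D' : Finset E}
    (hsub : D ⊆ D') (he : e ∉ D') {h : (E → O) → ℝ} (h0 : ∀ φ, 0 ≤ h φ)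
    (hb : ∀ φ, |h φ| ≤ 1) (hD : LocalOn D' h) :
    expect p (fun φ => h φ * (f (insert e D') φ - f D' φ)) ≤
      expect p (fun φ => h φ * marginal p f e (restrict φ D)) := by
  rw [← expect_mul_marginal hf e hb hD]
  exact expect_mono ((hasExpect_marginal hf e D').bdd_mul hb)
    ((hasExpect_marginal hf e D).bdd_mul hb)
    fun φ hφ => mul_le_mul_of_nonneg_left (marginal_restrict_anti hs hφ hsub he) (h0 φ)

end Restrict

/-! ### Random sets determined by the realization -/

section RandomSet

variable [Fintype E] [DecidableEq E]

/-- The random set `A(Φ)` is revealed by the states of its own items. -/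
def IsAdapted (A : (E → O) → Finset E) : Prop :=
  ∀ B, LocalOn B fun φ => if A φ = B then (1 : ℝ) else 0

theorem abs_ite_le_one (P : Prop) [Decidable P] : |if P then (1 : ℝ) else 0| ≤ 1 := by
  split_ifs <;> simp

theorem ite_nonneg_one_zero (P : Prop) [Decidable P] : 0 ≤ if P then (1 : ℝ) else 0 := by
  split_ifs <;> simp

/-- A random set takes finitely many values, so one splits over them with indicator weights. -/
theorem HasExpect.comp {p : PMF (E → O)} {X : Finset E → (E → O) → ℝ}
    (hX : ∀ B, HasExpect p (X B)) (A : (E → O) → Finset E) :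
    HasExpect p fun φ => X (A φ) φ := by
  have : (fun φ => X (A φ) φ) = fun φ => ∑ B, (if A φ = B then (1 : ℝ) else 0) * X B φ := by
    funext φ; simp
  rw [this]
  exact HasExpect.sum fun B _ => (hX B).bdd_mul fun φ => abs_ite_le_one _

theorem expect_comp {p : PMF (E → O)} {X : Finset E → (E → O) → ℝ}
    (hX : ∀ B, HasExpect p (X B)) (A : (E → O) → Finset E) :
    expect p (fun φ => X (A φ) φ) =
      ∑ B, expect p (fun φ => (if A φ = B then (1 : ℝ) else 0) * X B φ) := by
  rw [← expect_sum fun B _ => (hX B).bdd_mul fun φ => abs_ite_le_one _]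
  congr 1; funext φ; simp

end RandomSet

/-! ### The law of a policy -/

theorem toReal_apply_le_one {α : Type*} (q : PMF α) (a : α) : (q a).toReal ≤ 1 :=
  ENNReal.toReal_le_of_le_ofReal zero_le_one (by simpa using q.coe_le_one a)

theorem abs_toReal_apply_le_one {α : Type*} (q : PMF α) (a : α) : |(q a).toReal| ≤ 1 := by
  rw [abs_of_nonneg ENNReal.toReal_nonneg]; exact toReal_apply_le_one q a

theorem sum_toReal_eq_one {α : Type*} [Fintype α] (q : PMF α) : ∑ a, (q a).toReal = 1 := by
  rw [← ENNReal.toReal_sum fun a _ => q.apply_ne_top a,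
    ← tsum_fintype (L := .unconditional _), q.tsum_coe, ENNReal.toReal_one]

section Law

variable [Fintype E] [DecidableEq E]

/-- The expected value of `g` at the final selection after at most `n` further steps of `π` from
the selection `D`, under the realization `φ`. -/
def Policy.value (π : Policy E O) (φ : E → O) (g : Finset E → ℝ) : ℕ → Finset E → ℝ
  | 0, D => g D
  | n + 1, D => (π.next (restrict φ D) none).toReal * g D +
      ∑ e, (π.next (restrict φ D) (some e)).toReal * π.value φ g n (insert e D)

/-- Under a fixed `φ` every observation reached is a restriction of `φ`, so the run can be tracked
by the selected set alone. -/
theorem Policy.sum_run_eq_value (π : Policy E O) (φ : E → O) (g : Finset E → ℝ) (n : ℕ)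
    (D : Finset E) :
    ∑ T, ((π.run φ n (restrict φ D)).map dom T).toReal * g T = π.value φ g n D := by
  induction n generalizing D with
  | zero =>
    simp only [Policy.run, Policy.value, PMF.pure_map, dom_restrict, PMF.pure_apply]
    rw [Finset.sum_eq_single D] <;> simp +contextual
  | succ n ih =>
    have h : ∀ T, ((π.run φ (n + 1) (restrict φ D)).map dom T).toReal =
        (π.next (restrict φ D) none).toReal * (if T = D then 1 else 0) +
        ∑ e, (π.next (restrict φ D) (some e)).toReal *
          ((π.run φ n (restrict φ (insert e D))).map dom T).toReal := by
      intro T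
      rw [Policy.run, PMF.map_bind, PMF.bind_apply, tsum_fintype, Fintype.sum_option,
        ENNReal.toReal_add, ENNReal.toReal_mul, ENNReal.toReal_sum]
      · simp only [ENNReal.toReal_mul, update_restrict, PMF.pure_map, dom_restrict,
          PMF.pure_apply]
        congr 2
        split_ifs <;> simp
      · exact fun e _ => ENNReal.mul_ne_top (PMF.apply_ne_top _ _) (PMF.apply_ne_top _ _)
      · exact ENNReal.mul_ne_top (PMF.apply_ne_top _ _) (PMF.apply_ne_top _ _)
      · exact ENNReal.sum_ne_top.2
          fun e _ => ENNReal.mul_ne_top (PMF.apply_ne_top _ _) (PMF.apply_ne_top _ _)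
    simp_rw [h, Policy.value, ← ih, add_mul, Finset.sum_add_distrib, Finset.sum_mul,
      Finset.mul_sum]
    congr 1
    · rw [Finset.sum_eq_single D] <;> simp +contextual
    · rw [Finset.sum_comm]
      simp_rw [mul_assoc]

/-- The probability that `π` selects exactly `T` under `φ`. -/
def Policy.law (π : Policy E O) (φ : E → O) (T : Finset E) : ℝ := (π.selected φ T).toReal

theorem Policy.sum_law_mul (π : Policy E O) (φ : E → O) (g : Finset E → ℝ) :
    ∑ T, π.law φ T * g T = π.value φ g (Fintype.card E) ∅ := by
  rw [← π.sum_run_eq_value]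
  simp [Policy.law, Policy.selected]

theorem Policy.value_indicator_eq_zero (π : Policy E O) (φ : E → O) {T : Finset E} (n : ℕ)
    {D : Finset E} (hD : ¬ D ⊆ T) :
    π.value φ (fun S => if S = T then 1 else 0) n D = 0 := by
  have hne : D ≠ T := by rintro rfl; exact hD subset_rfl
  induction n generalizing D with
  | zero => rw [Policy.value, if_neg hne]
  | succ n ih =>
    rw [Policy.value, if_neg hne, mul_zero, zero_add]
    refine Finset.sum_eq_zero fun e _ => ?_
    have hs : ¬ insert e D ⊆ T := fun hs => hD ((Finset.subset_insert e D).trans hs)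
    rw [ih hs (by rintro h; exact hs h.subset), mul_zero]

/-- Selections only grow, so every observation on the way to the final selection `T` concerns items
of `T`; the action probabilities along such histories agree under `φ` and `φ'`. -/
theorem Policy.value_indicator_congr (π : Policy E O) {T : Finset E} {φ φ' : E → O}
    (h : ∀ e ∈ T, φ e = φ' e) (n : ℕ) (D : Finset E) :
    π.value φ (fun S => if S = T then 1 else 0) n D =
      π.value φ' (fun S => if S = T then 1 else 0) n D := by
  by_cases hD : D ⊆ T
  · induction n generalizing D with
    | zero => rfl
    | succ n ih =>
      rw [Policy.value, Policy.value, restrict_congr fun e he => h e (hD he)]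
      congr 1
      refine Finset.sum_congr rfl fun e _ => ?_
      by_cases he : insert e D ⊆ T
      · rw [ih _ he]
      · rw [π.value_indicator_eq_zero φ n he, π.value_indicator_eq_zero φ' n he]
  · rw [π.value_indicator_eq_zero φ n hD, π.value_indicator_eq_zero φ' n hD]

theorem Policy.law_local (π : Policy E O) (T : Finset E) : LocalOn T fun φ => π.law φ T := by
  intro φ φ' h
  have hlaw : ∀ φ, π.law φ T =
      π.value φ (fun S => if S = T then 1 else 0) (Fintype.card E) ∅ := by
    intro φ
    rw [← π.sum_law_mul]
    simp
  simp only [hlaw]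
  exact π.value_indicator_congr h _ _

theorem Policy.law_nonneg (π : Policy E O) (φ : E → O) (T : Finset E) : 0 ≤ π.law φ T :=
  ENNReal.toReal_nonneg

theorem Policy.abs_law_le_one (π : Policy E O) (φ : E → O) (T : Finset E) :
    |π.law φ T| ≤ 1 :=
  abs_toReal_apply_le_one _ _

theorem Policy.sum_law (π : Policy E O) (φ : E → O) : ∑ T, π.law φ T = 1 :=
  sum_toReal_eq_one _

theorem HasExpect.policy_value {p : PMF (E → O)} {X : Finset E → (E → O) → ℝ}
    (hX : ∀ D, HasExpect p (X D)) (π : Policy E O) (n : ℕ) (D : Finset E) :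
    HasExpect p fun φ => π.value φ (fun T => X T φ) n D := by
  induction n generalizing D with
  | zero => exact hX D
  | succ n ih =>
    simp only [Policy.value]
    exact ((hX D).bdd_mul fun φ => abs_toReal_apply_le_one _ _).add
      (HasExpect.sum fun e _ => (ih (insert e D)).bdd_mul fun φ => abs_toReal_apply_le_one _ _)

theorem HasExpect.sum_law {p : PMF (E → O)} {X : Finset E → (E → O) → ℝ}
    (hX : ∀ D, HasExpect p (X D)) (π : Policy E O) :
    HasExpect p fun φ => ∑ T, π.law φ T * X T φ :=
  HasExpect.sum fun T _ => (hX T).bdd_mul fun φ => π.abs_law_le_one φ T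

/-- If no fresh item increases the expectation of the potential `u`, weighted by any function of
the observed states (on the selection and on `B`), then neither does running a policy. -/
theorem Policy.expect_value_le {p : PMF (E → O)} (π : Policy E O) {u : Finset E → (E → O) → ℝ}
    (hu : ∀ D, HasExpect p (u D)) (B : Finset E)
    (hstep : ∀ (D : Finset E) (e : E) (h : (E → O) → ℝ), e ∉ D → (∀ φ, 0 ≤ h φ) →
      (∀ φ, |h φ| ≤ 1) → LocalOn (D ∪ B) h →
      expect p (fun φ => h φ * u (insert e D) φ) ≤ expect p (fun φ => h φ * u D φ))
    (n : ℕ) (D : Finset E) (h : (E → O) → ℝ) (h0 : ∀ φ, 0 ≤ h φ) (hb : ∀ φ, |h φ| ≤ 1)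
    (hl : LocalOn (D ∪ B) h) :
    expect p (fun φ => h φ * π.value φ (fun T => u T φ) n D) ≤
      expect p (fun φ => h φ * u D φ) := by
  induction n generalizing D h with
  | zero => exact le_rfl
  | succ n ih =>
    -- The probability of the next action is absorbed into the weight; this is why the induction
    -- quantifies over all local weights.
    have hwb : ∀ (a : Option E) φ, |h φ * (π.next (restrict φ D) a).toReal| ≤ 1 :=
      fun a φ => abs_mul_le_one (hb φ) (abs_toReal_apply_le_one _ _)
    have hw0 : ∀ (a : Option E) φ, 0 ≤ h φ * (π.next (restrict φ D) a).toReal :=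
      fun a φ => mul_nonneg (h0 φ) ENNReal.toReal_nonneg
    have hwl : ∀ a : Option E,
        LocalOn (D ∪ B) fun φ => h φ * (π.next (restrict φ D) a).toReal := by
      intro a
      refine hl.mul (LocalOn.mono (D := D) ?_ Finset.subset_union_left)
      intro φ φ' hφ
      simp only [restrict_congr hφ]
    have hterm : ∀ e : E,
        expect p (fun φ => h φ * (π.next (restrict φ D) (some e)).toReal *
          π.value φ (fun T => u T φ) n (insert e D)) ≤
        expect p (fun φ => h φ * (π.next (restrict φ D) (some e)).toReal * u D φ) := by
      intro e
      refine (ih (insert e D) _ (hw0 _) (hwb _) ((hwl _).mono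
        (Finset.union_subset_union_left (Finset.subset_insert e D)))).trans ?_
      by_cases he : e ∈ D
      · rw [Finset.insert_eq_of_mem he]
      · exact hstep D e _ he (hw0 _) (hwb _) (hwl _)
    have hL : (fun φ => h φ * π.value φ (fun T => u T φ) (n + 1) D) =
        fun φ => h φ * (π.next (restrict φ D) none).toReal * u D φ +
          ∑ e, h φ * (π.next (restrict φ D) (some e)).toReal *
            π.value φ (fun T => u T φ) n (insert e D) := by
      funext φ
      simp only [Policy.value, mul_add, Finset.mul_sum, mul_assoc]
    have hR : (fun φ => h φ * u D φ) =
        fun φ => h φ * (π.next (restrict φ D) none).toReal * u D φ +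
          ∑ e, h φ * (π.next (restrict φ D) (some e)).toReal * u D φ := by
      funext φ
      have h1 := sum_toReal_eq_one (π.next (restrict φ D))
      rw [Fintype.sum_option] at h1
      rw [← Finset.sum_mul, ← Finset.mul_sum, ← add_mul, ← mul_add, h1, mul_one]
    have hv := fun e => (HasExpect.policy_value hu π n (insert e D)).bdd_mul (hwb (some e))
    have hd := fun a => (hu D).bdd_mul (hwb a)
    rw [hL, hR, expect_add (hd none) (HasExpect.sum fun e _ => hv e),
      expect_add (hd none) (HasExpect.sum fun e _ => hd (some e)), expect_sum fun e _ => hv e,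
      expect_sum fun e _ => hd (some e)]
    exact add_le_add_right (Finset.sum_le_sum fun e _ => hterm e) _

/-- Adding the selection of a policy `π` to an adapted set `A` gains at most the sum of the
marginal utilities, given the states on `A`, of the items that `π` adds. -/
theorem Policy.expect_union_le {p : PMF (E → O)} {f : Finset E → (E → O) → ℝ}
    (hf : ∀ S, HasExpect p (f S)) (hs : IsAdaptiveSubmodular p f) (π : Policy E O)
    {A : (E → O) → Finset E} (hA : IsAdapted A) :
    expect p (fun φ => ∑ T, π.law φ T * f (T ∪ A φ) φ) ≤
      expect p (fun φ => f (A φ) φ) + expect p (fun φ => ∑ T, π.law φ T *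
        ∑ e ∈ T \ A φ, marginal p f e (restrict φ (A φ))) := by
  have hm : ∀ B T, HasExpect p fun φ => ∑ e ∈ T \ B, marginal p f e (restrict φ B) :=
    fun B T => HasExpect.sum fun e _ => hasExpect_marginal hf e B
  -- The potential is the value of the union minus the marginals charged so far; by adaptive
  -- submodularity a new item cannot raise its expectation.
  have hu : ∀ B T, HasExpect p
      fun φ => f (T ∪ B) φ - ∑ e ∈ T \ B, marginal p f e (restrict φ B) :=
    fun B T => (hf _).sub (hm B T)
  -- On the event `A φ = B`, whose indicator is local on `B`, the potential starts at `f B`.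
  have key : ∀ B, expect p (fun φ => (if A φ = B then (1 : ℝ) else 0) *
      ∑ T, π.law φ T * (f (T ∪ B) φ - ∑ e ∈ T \ B, marginal p f e (restrict φ B))) ≤
      expect p (fun φ => (if A φ = B then (1 : ℝ) else 0) * f B φ) := by
    intro B
    have := π.expect_value_le (hu B) B ?_ (Fintype.card E) ∅
      (fun φ => if A φ = B then (1 : ℝ) else 0) (fun φ => ite_nonneg_one_zero _)
      (fun φ => abs_ite_le_one _) (by simpa using hA B)
    · simpa [Policy.sum_law_mul] using this
    · intro D e h he h0 hb hl
      by_cases heB : e ∈ B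
      · rw [Finset.insert_union, Finset.insert_eq_of_mem (Finset.mem_union_right D heB),
          Finset.insert_sdiff_of_mem _ heB]
      · have h1 := expect_mul_gain_le hf hs (D := B) (D' := D ∪ B) Finset.subset_union_right
          (e := e) (by simp [he, heB]) h0 hb hl
        have h2 : (fun φ => h φ * (f (insert e D ∪ B) φ -
            ∑ e ∈ insert e D \ B, marginal p f e (restrict φ B))) =
            fun φ => h φ * (f (D ∪ B) φ - ∑ e ∈ D \ B, marginal p f e (restrict φ B)) +
              (h φ * (f (insert e (D ∪ B)) φ - f (D ∪ B) φ) -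
                h φ * marginal p f e (restrict φ B)) := by
          funext φ
          rw [Finset.insert_sdiff_of_notMem _ heB,
            Finset.sum_insert (by simp [he]), Finset.insert_union]
          ring
        have h3 := ((hf (insert e (D ∪ B))).sub (hf (D ∪ B))).bdd_mul hb
        have h4 := (hasExpect_marginal hf e B).bdd_mul hb
        rw [h2, expect_add ((hu B D).bdd_mul hb) (h3.sub h4), expect_sub h3 h4]
        linarith
  have hsum := Finset.sum_le_sum fun B (_ : B ∈ Finset.univ) => key B
  rw [← expect_comp (fun B => HasExpect.sum_law (hu B) π) A, ← expect_comp hf A] at hsum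
  have hsplit : (fun φ => ∑ T, π.law φ T * (f (T ∪ A φ) φ -
      ∑ e ∈ T \ A φ, marginal p f e (restrict φ (A φ)))) = fun φ =>
      ∑ T, π.law φ T * f (T ∪ A φ) φ -
        ∑ T, π.law φ T * ∑ e ∈ T \ A φ, marginal p f e (restrict φ (A φ)) := by
    funext φ
    simp only [mul_sub, Finset.sum_sub_distrib]
  rw [hsplit, expect_sub (HasExpect.sum_law (fun T => HasExpect.comp (fun B => hf (T ∪ B)) A) π)
    (HasExpect.sum_law (fun T => HasExpect.comp (fun B => hm B T) A) π)] at hsum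
  linarith

end Law

/-! ### The run of the greedy policy -/

section Greedy

variable [Fintype E] [DecidableEq E] (p : PMF (E → O)) (f : Finset E → (E → O) → ℝ)
  (I : Set (Finset E)) (tie : PartialRealization E O → (E ↪ ℕ))

theorem isGreedyChoice_of_greedyStep {S : Finset E} {ψ : PartialRealization E O} {e : E}
    (h : greedyStep p f I tie S ψ = some e) :
    IsGreedyChoice p f (tie ψ) (candidates p f I S ψ) ψ e := by
  unfold greedyStep at h
  split_ifs at h with hne
  have hc := (exists_isGreedyChoice p f (tie ψ) _ ψ hne).choose_spec
  rwa [Option.some.inj h] at hc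

/-- Injective labels settle every tie. Without this, greedy runs on `S` and on `S ∪ {t}` could
diverge before `t` is selected. -/
theorem IsGreedyChoice.unique {p : PMF (E → O)} {f : Finset E → (E → O) → ℝ} {label : E ↪ ℕ}
    {F : Finset E} {ψ : PartialRealization E O} {e e' : E}
    (h : IsGreedyChoice p f label F ψ e) (h' : IsGreedyChoice p f label F ψ e') : e = e' := by
  have heq : marginal p f e ψ = marginal p f e' ψ :=
    le_antisymm (h'.2.1 e h.1) (h.2.1 e' h'.1)
  exact label.injective (le_antisymm (h.2.2 e' h'.1 heq.symm) (h'.2.2 e h.1 heq))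

theorem greedyStep_eq_some_iff {S : Finset E} {ψ : PartialRealization E O} {e : E} :
    greedyStep p f I tie S ψ = some e ↔
      IsGreedyChoice p f (tie ψ) (candidates p f I S ψ) ψ e := by
  refine ⟨isGreedyChoice_of_greedyStep p f I tie, fun h => ?_⟩
  have hne : (candidates p f I S ψ).Nonempty := ⟨e, h.1⟩
  unfold greedyStep
  rw [dif_pos hne]
  exact congrArg some
    (IsGreedyChoice.unique (exists_isGreedyChoice p f (tie ψ) _ ψ hne).choose_spec h)

theorem greedyStep_eq_none_iff {S : Finset E} {ψ : PartialRealization E O} :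
    greedyStep p f I tie S ψ = none ↔ candidates p f I S ψ = ∅ := by
  unfold greedyStep
  split_ifs with h
  · simpa using h.ne_empty
  · simpa [Finset.not_nonempty_iff_eq_empty] using h

theorem mem_candidates_restrict {S D : Finset E} {φ : E → O} {e : E} :
    e ∈ candidates p f I S (restrict φ D) ↔
      e ∈ S ∧ e ∉ D ∧ insert e D ∈ I ∧ 0 < marginal p f e (restrict φ D) := by
  simp [candidates, restrict_eq_none]

theorem mem_candidates_of_greedyStep {S : Finset E} {ψ : PartialRealization E O} {e : E}
    (h : greedyStep p f I tie S ψ = some e) : e ∈ candidates p f I S ψ :=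
  (isGreedyChoice_of_greedyStep p f I tie h).1

/-- The selection after one more step of the greedy policy on `S` from the selection `D`. -/
def greedyNext (S : Finset E) (φ : E → O) (D : Finset E) : Finset E :=
  (greedyStep p f I tie S (restrict φ D)).elim D fun e => insert e D

/-- The first `i` items selected by the greedy policy on `S`. -/
def stage (S : Finset E) (i : ℕ) (φ : E → O) : Finset E := (greedyNext p f I tie S φ)^[i] ∅

/-- The items selected by the greedy policy on `S`. -/
def greedySet (S : Finset E) (φ : E → O) : Finset E := stage p f I tie S (Fintype.card E) φ

theorem stage_zero (S : Finset E) (φ : E → O) : stage p f I tie S 0 φ = ∅ := rfl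

theorem stage_succ (S : Finset E) (i : ℕ) (φ : E → O) :
    stage p f I tie S (i + 1) φ = greedyNext p f I tie S φ (stage p f I tie S i φ) :=
  Function.iterate_succ_apply' _ _ _

variable {p f I tie}

theorem stage_succ_of_none {S : Finset E} {i : ℕ} {φ : E → O}
    (h : greedyStep p f I tie S (restrict φ (stage p f I tie S i φ)) = none) :
    stage p f I tie S (i + 1) φ = stage p f I tie S i φ := by
  rw [stage_succ, greedyNext, h, Option.elim_none]

theorem stage_succ_of_some {S : Finset E} {i : ℕ} {φ : E → O} {e : E}
    (h : greedyStep p f I tie S (restrict φ (stage p f I tie S i φ)) = some e) :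
    stage p f I tie S (i + 1) φ = insert e (stage p f I tie S i φ) := by
  rw [stage_succ, greedyNext, h, Option.elim_some]

theorem stage_subset_succ (S : Finset E) (i : ℕ) (φ : E → O) :
    stage p f I tie S i φ ⊆ stage p f I tie S (i + 1) φ := by
  cases h : greedyStep p f I tie S (restrict φ (stage p f I tie S i φ)) with
  | none => rw [stage_succ_of_none h]
  | some e => rw [stage_succ_of_some h]; exact Finset.subset_insert _ _

theorem stage_mono (S : Finset E) (φ : E → O) : Monotone fun i => stage p f I tie S i φ :=
  monotone_nat_of_le_succ fun i => stage_subset_succ S i φ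

theorem stage_subset (S : Finset E) (i : ℕ) (φ : E → O) : stage p f I tie S i φ ⊆ S := by
  induction i with
  | zero => simp [stage_zero]
  | succ i ih =>
    cases h : greedyStep p f I tie S (restrict φ (stage p f I tie S i φ)) with
    | none => rwa [stage_succ_of_none h]
    | some e =>
      rw [stage_succ_of_some h]
      have := mem_candidates_of_greedyStep p f I tie h
      rw [mem_candidates_restrict] at this
      exact Finset.insert_subset this.1 ih

theorem stage_mem (hI : ∅ ∈ I) (S : Finset E) (i : ℕ) (φ : E → O) :
    stage p f I tie S i φ ∈ I := by
  induction i with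
  | zero => simpa [stage_zero]
  | succ i ih =>
    cases h : greedyStep p f I tie S (restrict φ (stage p f I tie S i φ)) with
    | none => rwa [stage_succ_of_none h]
    | some e =>
      rw [stage_succ_of_some h]
      have := mem_candidates_of_greedyStep p f I tie h
      rw [mem_candidates_restrict] at this
      exact this.2.2.1

theorem card_stage_le (S : Finset E) (i : ℕ) (φ : E → O) :
    (stage p f I tie S i φ).card ≤ i := by
  induction i with
  | zero => simp [stage_zero]
  | succ i ih =>
    cases h : greedyStep p f I tie S (restrict φ (stage p f I tie S i φ)) with
    | none => rw [stage_succ_of_none h]; exact ih.trans i.le_succ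
    | some e =>
      rw [stage_succ_of_some h]
      exact (Finset.card_insert_le _ _).trans (Nat.succ_le_succ ih)

/-- The greedy rule consults only states already revealed, all of which belong to items of the final
stage. -/
theorem stage_congr (S : Finset E) (i : ℕ) {φ φ' : E → O}
    (h : ∀ e ∈ stage p f I tie S i φ, φ e = φ' e) :
    stage p f I tie S i φ' = stage p f I tie S i φ := by
  induction i with
  | zero => rfl
  | succ i ih =>
    have h' : ∀ e ∈ stage p f I tie S i φ, φ e = φ' e :=
      fun e he => h e (stage_subset_succ S i φ he)
    rw [stage_succ, stage_succ, ih h', greedyNext, greedyNext, restrict_congr h']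

theorem isAdapted_stage (S : Finset E) (i : ℕ) : IsAdapted (stage p f I tie S i) := by
  intro B φ φ' h
  have : stage p f I tie S i φ = B ↔ stage p f I tie S i φ' = B := by
    constructor
    · rintro rfl; exact stage_congr S i h
    · rintro rfl; exact stage_congr S i fun e he => (h e he).symm
  simp only [this]

theorem isAdapted_greedySet (S : Finset E) : IsAdapted (greedySet p f I tie S) :=
  isAdapted_stage S _

theorem greedyStep_isSome_of_succ {S : Finset E} {i : ℕ} {φ : E → O}
    (h : (greedyStep p f I tie S (restrict φ (stage p f I tie S (i + 1) φ))).isSome) :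
    (greedyStep p f I tie S (restrict φ (stage p f I tie S i φ))).isSome := by
  cases h' : greedyStep p f I tie S (restrict φ (stage p f I tie S i φ)) with
  | none => rw [stage_succ_of_none h', h'] at h; exact h
  | some e => rfl

/-- A run that can still continue has never paused, so each earlier step added a new item. -/
theorem card_stage_of_isSome {S : Finset E} {i : ℕ} {φ : E → O}
    (h : (greedyStep p f I tie S (restrict φ (stage p f I tie S i φ))).isSome) :
    (stage p f I tie S i φ).card = i := by
  induction i with
  | zero => simp [stage_zero]
  | succ i ih =>
    have h' := greedyStep_isSome_of_succ h
    obtain ⟨e, he⟩ := Option.isSome_iff_exists.1 h'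
    have hc := mem_candidates_of_greedyStep p f I tie he
    rw [mem_candidates_restrict] at hc
    rw [stage_succ_of_some he, Finset.card_insert_of_notMem hc.2.1, ih h']

/-- The greedy policy has stopped after `|E|` steps. -/
theorem greedyStep_greedySet (S : Finset E) (φ : E → O) :
    greedyStep p f I tie S (restrict φ (greedySet p f I tie S φ)) = none := by
  rw [← Option.not_isSome_iff_eq_none]
  intro h
  have huniv := (Finset.card_eq_iff_eq_univ _).1 (card_stage_of_isSome h)
  obtain ⟨e, he⟩ := Option.isSome_iff_exists.1 h
  have hc := mem_candidates_of_greedyStep p f I tie he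
  rw [mem_candidates_restrict, greedySet, huniv] at hc
  exact hc.2.1 (Finset.mem_univ e)

theorem greedyPolicy_run (S : Finset E) (φ : E → O) (n : ℕ) (D : Finset E) :
    (greedyPolicy p f I tie S).run φ n (restrict φ D) =
      PMF.pure (restrict φ ((greedyNext p f I tie S φ)^[n] D)) := by
  induction n generalizing D with
  | zero => rfl
  | succ n ih =>
    rw [Policy.run, greedyPolicy, PMF.pure_bind, Function.iterate_succ_apply]
    cases h : greedyStep p f I tie S (restrict φ D) with
    | none =>
      have hD : greedyNext p f I tie S φ D = D := by rw [greedyNext, h, Option.elim_none]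
      rw [hD, Function.iterate_fixed hD]
    | some e =>
      have hD : greedyNext p f I tie S φ D = insert e D := by
        rw [greedyNext, h, Option.elim_some]
      rw [hD, ← ih]
      simp only [update_restrict]
      rfl

theorem greedyPolicy_selected (S : Finset E) (φ : E → O) :
    (greedyPolicy p f I tie S).selected φ = PMF.pure (greedySet p f I tie S φ) := by
  rw [Policy.selected, ← restrict_empty φ, greedyPolicy_run, PMF.pure_map, dom_restrict]
  rfl

/-! ### Expected gains along the greedy run -/

/-- The event that the current stage is `B` and the next item is `e` is determined by the states on
`B`. Splitting over all pairs `(B, e)` reduces a claim about a random step to one about fixed `B`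
and `e` with a local weight; a stopped run contributes `0`. -/
theorem expect_greedyStep_nonpos {S : Finset E} {x : Finset E → E → (E → O) → ℝ}
    (hx : ∀ B e, HasExpect p (x B e))
    (H : ∀ (B : Finset E) (e : E) (h : (E → O) → ℝ), e ∈ S → e ∉ B → (∀ φ, 0 ≤ h φ) →
      (∀ φ, |h φ| ≤ 1) → LocalOn B h → expect p (fun φ => h φ * x B e φ) ≤ 0) (i : ℕ) :
    HasExpect p (fun φ => (greedyStep p f I tie S (restrict φ (stage p f I tie S i φ))).elim 0
      fun e => x (stage p f I tie S i φ) e φ) ∧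
    expect p (fun φ => (greedyStep p f I tie S (restrict φ (stage p f I tie S i φ))).elim 0
      fun e => x (stage p f I tie S i φ) e φ) ≤ 0 := by
  set h : Finset E → E → (E → O) → ℝ := fun B e φ =>
    (if stage p f I tie S i φ = B then 1 else 0) *
      (if greedyStep p f I tie S (restrict φ B) = some e then 1 else 0) with hh
  have h0 : ∀ B e φ, 0 ≤ h B e φ :=
    fun B e φ => mul_nonneg (ite_nonneg_one_zero _) (ite_nonneg_one_zero _)
  have hb : ∀ B e φ, |h B e φ| ≤ 1 :=
    fun B e φ => abs_mul_le_one (abs_ite_le_one _) (abs_ite_le_one _)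
  have hl : ∀ B e, LocalOn B (h B e) := by
    refine fun B e => (isAdapted_stage S i B).mul fun φ φ' hφ => ?_
    simp only [restrict_congr hφ]
  have heq : (fun φ => (greedyStep p f I tie S (restrict φ (stage p f I tie S i φ))).elim 0
      fun e => x (stage p f I tie S i φ) e φ) = fun φ => ∑ B, ∑ e, h B e φ * x B e φ := by
    funext φ
    rw [Finset.sum_eq_single (stage p f I tie S i φ)]
    · cases hg : greedyStep p f I tie S (restrict φ (stage p f I tie S i φ)) with
      | none => simp [hh, hg]
      | some e => simp [hh, hg]
    · intro B _ hB
      simp [hh, hB.symm]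
    · simp
  have hint : ∀ B e, HasExpect p fun φ => h B e φ * x B e φ :=
    fun B e => (hx B e).bdd_mul (hb B e)
  have hint' : ∀ B, HasExpect p fun φ => ∑ e, h B e φ * x B e φ :=
    fun B => HasExpect.sum fun e _ => hint B e
  rw [heq, expect_sum fun B _ => hint' B]
  refine ⟨HasExpect.sum fun B _ => hint' B, Finset.sum_nonpos fun B _ => ?_⟩
  rw [expect_sum fun e _ => hint B e]
  refine Finset.sum_nonpos fun e _ => ?_
  by_cases he : e ∈ S ∧ e ∉ B
  · exact H B e _ he.1 he.2 (h0 B e) (hb B e) (hl B e)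
  · have hz : (fun φ => h B e φ * x B e φ) = fun _ => 0 := by
      funext φ
      have : greedyStep p f I tie S (restrict φ B) ≠ some e := fun hg => he (by
        have := mem_candidates_of_greedyStep p f I tie hg
        rw [mem_candidates_restrict] at this
        exact ⟨this.1, this.2.1⟩)
      simp [hh, this]
    rw [hz]
    simp [expect]

variable (p f I tie) in
/-- The conditional expected marginal utility of the `(i+1)`-st greedy item. -/
def stepGain (S : Finset E) (i : ℕ) (φ : E → O) : ℝ :=
  (greedyStep p f I tie S (restrict φ (stage p f I tie S i φ))).elim 0
    fun e => marginal p f e (restrict φ (stage p f I tie S i φ))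

variable (p f I tie) in
/-- The total conditional expected marginal utility along the greedy run. -/
def gain (S : Finset E) (φ : E → O) : ℝ :=
  ∑ i ∈ Finset.range (Fintype.card E), stepGain p f I tie S i φ

/-- By the tower property, marginal and actual gain of a greedy step have the same expectation; only
one inequality is needed. -/
theorem hasExpect_stepGain (hf : ∀ S, HasExpect p (f S)) (S : Finset E) (i : ℕ) :
    HasExpect p (stepGain p f I tie S i) ∧ expect p (stepGain p f I tie S i) ≤
      expect p (fun φ => f (stage p f I tie S (i + 1) φ) φ) -
        expect p (fun φ => f (stage p f I tie S i φ) φ) := by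
  have h1 : HasExpect p fun φ => f (stage p f I tie S (i + 1) φ) φ := HasExpect.comp hf _
  have h2 : HasExpect p fun φ => f (stage p f I tie S i φ) φ := HasExpect.comp hf _
  have h := expect_greedyStep_nonpos (p := p) (f := f) (I := I) (tie := tie) (S := S)
    (x := fun B e φ => marginal p f e (restrict φ B) - (f (insert e B) φ - f B φ))
    (fun B e => (hasExpect_marginal hf e B).sub ((hf _).sub (hf _)))
    (fun B e h _ _ _ hb hl => by
      simp only [mul_sub (h _)]
      have := expect_mul_marginal hf e hb hl
      simp only [mul_sub (h _)] at this
      rw [expect_sub ((hasExpect_marginal hf e B).bdd_mul hb)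
        (((hf _).bdd_mul hb).sub ((hf _).bdd_mul hb)), this, sub_self]) i
  have heq : (fun φ => (greedyStep p f I tie S (restrict φ (stage p f I tie S i φ))).elim 0
      fun e => marginal p f e (restrict φ (stage p f I tie S i φ)) -
        (f (insert e (stage p f I tie S i φ)) φ - f (stage p f I tie S i φ) φ)) =
      fun φ => stepGain p f I tie S i φ -
        (f (stage p f I tie S (i + 1) φ) φ - f (stage p f I tie S i φ) φ) := by
    funext φ
    cases hg : greedyStep p f I tie S (restrict φ (stage p f I tie S i φ)) with
    | none => simp [stepGain, hg, stage_succ_of_none hg]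
    | some e => simp [stepGain, hg, stage_succ_of_some hg]
  rw [heq] at h
  -- Integrability is recovered by adding the actual gain back to the integrable difference.
  have hd : HasExpect p (stepGain p f I tie S i) := by
    simpa using h.1.add (h1.sub h2)
  refine ⟨hd, ?_⟩
  rw [← expect_sub h1 h2, ← sub_nonpos, ← expect_sub hd (h1.sub h2)]
  exact h.2

theorem hasExpect_gain (hf : ∀ S, HasExpect p (f S)) (S : Finset E) :
    HasExpect p (gain p f I tie S) :=
  HasExpect.sum fun i _ => (hasExpect_stepGain hf S i).1

/-- The step gains telescope, and the initial value `f ∅` is dropped as non-negative. -/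
theorem expect_gain_le (hf : ∀ S, HasExpect p (f S)) (h0 : ∀ S φ, 0 ≤ f S φ) (S : Finset E) :
    expect p (gain p f I tie S) ≤ expect p (fun φ => f (greedySet p f I tie S φ) φ) := by
  have h : expect p (gain p f I tie S) ≤ expect p (fun φ => f (greedySet p f I tie S φ) φ) -
      expect p (f ∅) := by
    unfold gain
    rw [expect_sum fun i _ => (hasExpect_stepGain hf S i).1]
    refine (Finset.sum_le_sum fun i _ => (hasExpect_stepGain hf S i).2).trans ?_
    rw [Finset.sum_range_sub (fun i => expect p (fun φ => f (stage p f I tie S i φ) φ))]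
    rfl
  linarith [expect_nonneg (p := p) (h0 ∅)]

/-- Two greedy runs on disjoint sets cannot both spoil the selection of a policy. -/
theorem Policy.expect_le_union_add_union (hf : ∀ S, HasExpect p (f S)) (h0 : ∀ S φ, 0 ≤ f S φ)
    (hs : IsAdaptiveSubmodular p f) (π : Policy E O) {S : Finset E}
    {A : (E → O) → Finset E} (hA : IsAdapted A) (hAS : ∀ φ, Disjoint (A φ) S) :
    expect p (fun φ => ∑ T, π.law φ T * f T φ) ≤
      expect p (fun φ => ∑ T, π.law φ T * f (T ∪ greedySet p f I tie S φ) φ) +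
        expect p (fun φ => ∑ T, π.law φ T * f (T ∪ A φ) φ) := by
  -- The potential is what `A` adds on top of `T ∪ D`. It does not increase in expectation as `D`
  -- runs through the greedy stages on `S`.
  set u : Finset E → (E → O) → ℝ := fun D φ =>
    ∑ T, π.law φ T * f (T ∪ D ∪ A φ) φ - ∑ T, π.law φ T * f (T ∪ D) φ with hu_def
  have hfA : ∀ D, HasExpect p fun φ => ∑ T, π.law φ T * f (T ∪ D ∪ A φ) φ :=
    fun D => HasExpect.sum_law (fun T => HasExpect.comp (fun B => hf (T ∪ D ∪ B)) A) π
  have hfD : ∀ D, HasExpect p fun φ => ∑ T, π.law φ T * f (T ∪ D) φ :=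
    fun D => HasExpect.sum_law (fun T => hf (T ∪ D)) π
  have hu : ∀ D, HasExpect p (u D) := fun D => (hfA D).sub (hfD D)
  have hstep : ∀ (B : Finset E) (e : E) (h : (E → O) → ℝ), e ∈ S → e ∉ B → (∀ φ, 0 ≤ h φ) →
      (∀ φ, |h φ| ≤ 1) → LocalOn B h →
      expect p (fun φ => h φ * (u (insert e B) φ - u B φ)) ≤ 0 := by
    intro B e h heS heB hh0 hb hl
    -- the contribution of a fixed selection `T` of `π` and a fixed value `C` of `A`
    have key : ∀ T, expect p (fun φ => h φ * π.law φ T *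
        (f (insert e (T ∪ B) ∪ A φ) φ - f (T ∪ B ∪ A φ) φ)) ≤
        expect p (fun φ => h φ * π.law φ T * (f (insert e (T ∪ B)) φ - f (T ∪ B) φ)) := by
      intro T
      by_cases heT : e ∈ T
      · have : insert e (T ∪ B) = T ∪ B :=
          Finset.insert_eq_of_mem (Finset.mem_union_left B heT)
        simp [this]
      have hwb : ∀ φ, |h φ * π.law φ T| ≤ 1 :=
        fun φ => abs_mul_le_one (hb φ) (π.abs_law_le_one φ T)
      have hwl : LocalOn (T ∪ B) fun φ => h φ * π.law φ T :=
        (hl.mono Finset.subset_union_right).mul ((π.law_local T).mono Finset.subset_union_left)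
      -- The right side must become a marginal now, while its weight is local on `T ∪ B`; the
      -- indicator of `A φ = C`, which is not, is introduced only afterwards.
      rw [← expect_mul_marginal hf e hwb hwl]
      rw [expect_comp (X := fun C φ => h φ * π.law φ T *
        (f (insert e (T ∪ B) ∪ C) φ - f (T ∪ B ∪ C) φ))
        (fun C => ((hf _).sub (hf _)).bdd_mul hwb) A]
      have hm := (hasExpect_marginal hf e (T ∪ B)).bdd_mul hwb
      rw [expect_comp (X := fun _ φ => h φ * π.law φ T * marginal p f e (restrict φ (T ∪ B)))
        (fun _ => hm) A]
      refine Finset.sum_le_sum fun C _ => ?_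
      simp only [← mul_assoc]
      -- This value of `A` never occurs, because `A` avoids `S` and `e` lies in `S`.
      by_cases heC : e ∈ C
      · have hz : ∀ φ, (if A φ = C then (1 : ℝ) else 0) = 0 := by
          intro φ
          rw [if_neg]
          rintro rfl
          exact Finset.disjoint_left.1 (hAS φ) heC heS
        simp [hz]
      rw [Finset.insert_union]
      refine expect_mul_gain_le hf hs Finset.subset_union_left (by simp [heT, heB, heC])
        (fun φ => ?_) (fun φ => ?_) ?_
      · exact mul_nonneg (mul_nonneg (ite_nonneg_one_zero _) (hh0 φ)) (π.law_nonneg φ T)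
      · exact abs_mul_le_one (abs_mul_le_one (abs_ite_le_one _) (hb φ)) (π.abs_law_le_one φ T)
      · simp only [mul_assoc]
        exact ((hA C).mono Finset.subset_union_right).mul (hwl.mono Finset.subset_union_left)
    have hwb : ∀ T φ, |h φ * π.law φ T| ≤ 1 :=
      fun T φ => abs_mul_le_one (hb φ) (π.abs_law_le_one φ T)
    have hi1 : ∀ T, HasExpect p fun φ => h φ * π.law φ T *
        (f (insert e (T ∪ B) ∪ A φ) φ - f (T ∪ B ∪ A φ) φ) := fun T =>
      ((HasExpect.comp (fun C => hf (insert e (T ∪ B) ∪ C)) A).sub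
        (HasExpect.comp (fun C => hf (T ∪ B ∪ C)) A)).bdd_mul (hwb T)
    have hi2 : ∀ T, HasExpect p fun φ => h φ * π.law φ T *
        (f (insert e (T ∪ B)) φ - f (T ∪ B) φ) := fun T =>
      ((hf _).sub (hf _)).bdd_mul (hwb T)
    have hsplit : (fun φ => h φ * (u (insert e B) φ - u B φ)) = fun φ =>
        ∑ T, h φ * π.law φ T * (f (insert e (T ∪ B) ∪ A φ) φ - f (T ∪ B ∪ A φ) φ) -
        ∑ T, h φ * π.law φ T * (f (insert e (T ∪ B)) φ - f (T ∪ B) φ) := by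
      funext φ
      simp only [hu_def, Finset.union_insert, mul_assoc, mul_sub, Finset.mul_sum,
        Finset.sum_sub_distrib]
      ring
    rw [hsplit, expect_sub (HasExpect.sum fun T _ => hi1 T) (HasExpect.sum fun T _ => hi2 T),
      expect_sum fun T _ => hi1 T, expect_sum fun T _ => hi2 T, sub_nonpos]
    exact Finset.sum_le_sum fun T _ => key T
  have hmono : ∀ i, expect p (fun φ => u (stage p f I tie S i φ) φ) ≤ expect p (u ∅) := by
    intro i
    induction i with
    | zero => exact le_rfl
    | succ i ih =>
      have h := (expect_greedyStep_nonpos (p := p) (f := f) (I := I) (tie := tie) (S := S)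
        (x := fun B e φ => u (insert e B) φ - u B φ) (fun B e => (hu _).sub (hu _)) hstep i).2
      have heq : (fun φ => (greedyStep p f I tie S (restrict φ (stage p f I tie S i φ))).elim 0
          fun e => u (insert e (stage p f I tie S i φ)) φ - u (stage p f I tie S i φ) φ) =
          fun φ => u (stage p f I tie S (i + 1) φ) φ - u (stage p f I tie S i φ) φ := by
        funext φ
        cases hg : greedyStep p f I tie S (restrict φ (stage p f I tie S i φ)) with
        | none => simp [stage_succ_of_none hg]
        | some e => simp [stage_succ_of_some hg]
      rw [heq, expect_sub (HasExpect.comp hu _) (HasExpect.comp hu _)] at h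
      linarith
  have h := hmono (Fintype.card E)
  simp only [hu_def, Finset.union_empty] at h
  have i1 := HasExpect.comp hfA (stage p f I tie S (Fintype.card E))
  have i2 := HasExpect.comp hfD (stage p f I tie S (Fintype.card E))
  have i3 : HasExpect p fun φ => ∑ T, π.law φ T * f (T ∪ A φ) φ := by simpa using hfA ∅
  have i4 : HasExpect p fun φ => ∑ T, π.law φ T * f T φ := by simpa using hfD ∅
  rw [expect_sub i1 i2, expect_sub i3 i4] at h
  -- Discarding the value of the triple union is where non-negativity of `f` stands in for
  -- monotonicity.
  have hnn : 0 ≤ expect p (fun φ => ∑ T, π.law φ T *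
      f (T ∪ stage p f I tie S (Fintype.card E) φ ∪ A φ) φ) :=
    expect_nonneg fun φ => Finset.sum_nonneg fun T _ => mul_nonneg (π.law_nonneg φ T) (h0 _ _)
  unfold greedySet
  linarith

end Greedy

/-! ### Charging independent items to the greedy run -/

/-- If at most `k * i` indices are assigned to the first `i` positions of an antitone sequence
`d`, then the assigned values sum to at most `k` times the sum of the sequence. -/
theorem sum_filter_add_le_mul_sum {ι : Type*} {s : Finset ι} {j : ι → ℕ} {d : ℕ → ℝ}
    (hd : Antitone d) {k : ℕ} (hc : ∀ i, (s.filter fun t => j t < i).card ≤ k * i) (m : ℕ) :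
    ∑ t ∈ s.filter (fun t => j t < m), d (j t) +
      (k * m - (s.filter fun t => j t < m).card) * d m ≤ k * ∑ i ∈ Finset.range m, d i := by
  classical
  -- Summation by parts: the second term prices the unused capacity `k * m - count` at the current
  -- value `d m`, so that passing to the smaller `d (m + 1)` only helps.
  induction m with
  | zero => simp
  | succ m ih =>
    have hsplit : s.filter (fun t => j t < m + 1) =
        s.filter (fun t => j t < m) ∪ s.filter (fun t => j t = m) := by
      ext t
      simp only [Finset.mem_filter, Finset.mem_union, Nat.lt_succ_iff_lt_or_eq]
      tauto
    have hdisj : Disjoint (s.filter fun t => j t < m) (s.filter fun t => j t = m) :=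
      Finset.disjoint_filter.2 fun t _ h1 h2 => h1.ne h2
    have heq : ∑ t ∈ s.filter (fun t => j t = m), d (j t) =
        (s.filter fun t => j t = m).card * d m := by
      rw [Finset.sum_congr rfl fun t ht => by rw [(Finset.mem_filter.1 ht).2],
        Finset.sum_const, nsmul_eq_mul]
    have hcard : ((s.filter fun t => j t < m + 1).card : ℝ) =
        (s.filter fun t => j t < m).card + (s.filter fun t => j t = m).card := by
      rw [hsplit, Finset.card_union_of_disjoint hdisj, Nat.cast_add]
    have hk : ((s.filter fun t => j t < m + 1).card : ℝ) ≤ k * ((m : ℝ) + 1) := by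
      exact_mod_cast hc (m + 1)
    have hmul := mul_le_mul_of_nonneg_left (hd m.le_succ) (sub_nonneg.2 hk)
    rw [Finset.sum_range_succ, hcard, Nat.cast_add, Nat.cast_one]
    rw [hcard] at hmul
    rw [hsplit, Finset.sum_union hdisj, heq]
    simp only [Nat.succ_eq_add_one] at hmul
    linarith

theorem exists_isBaseOf_superset [Finite E] {I : Set (Finset E)} {R U : Finset E} (hU : U ∈ I)
    (hUR : U ⊆ R) : ∃ B, IsBaseOf I R B ∧ U ⊆ B := by
  obtain ⟨B, hUB, hB⟩ := (Set.toFinite {A : Finset E | A ∈ I ∧ A ⊆ R}).exists_le_maximal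
    (show U ∈ {A : Finset E | A ∈ I ∧ A ⊆ R} from ⟨hU, hUR⟩)
  exact ⟨B, ⟨hB.prop, fun A hA hAR hBA => hB.eq_of_le ⟨hA, hAR⟩ hBA⟩, hUB⟩

/-- In a `k`-system, an independent set of items none of which can be added to the independent
set `D` has at most `k * |D|` elements. -/
theorem IsKSystem.card_le [Finite E] [DecidableEq E] {I : Set (Finset E)} {k : ℕ}
    (hI : IsKSystem I k) {D U : Finset E} (hD : D ∈ I) (hU : U ∈ I)
    (h : ∀ t ∈ U, t ∉ D → insert t D ∉ I) : U.card ≤ k * D.card := by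
  -- Both `D` and an extension of `U` are bases of `D ∪ U`.
  obtain ⟨B, hB, hUB⟩ := exists_isBaseOf_superset hU (Finset.subset_union_right (s₁ := D))
  refine (Finset.card_le_card hUB).trans (hI.2.2 (D ∪ U) B D hB ⟨⟨hD, Finset.subset_union_left⟩,
    fun A hA hAR hDA => hDA.antisymm fun t ht => ?_⟩)
  by_contra htD
  have htU : t ∈ U := (Finset.mem_union.1 (hAR ht)).resolve_left htD
  exact h t htU htD (hI.1.2 A hA _ (Finset.insert_subset ht hDA))

section Charging

variable [Fintype E] [DecidableEq E] {p : PMF (E → O)} {f : Finset E → (E → O) → ℝ}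
  {I : Set (Finset E)} {tie : PartialRealization E O → (E ↪ ℕ)}

theorem candidates_mono {S S' : Finset E} (h : S ⊆ S') (ψ : PartialRealization E O) :
    candidates p f I S ψ ⊆ candidates p f I S' ψ := by
  classical
  exact Finset.filter_subset_filter _ h

/-- An additional item that is not chosen does not change the greedy choice. -/
theorem greedyStep_insert_of_ne {S : Finset E} {t : E} {ψ : PartialRealization E O}
    (h : greedyStep p f I tie (insert t S) ψ ≠ some t) :
    greedyStep p f I tie (insert t S) ψ = greedyStep p f I tie S ψ := by
  have hsub := candidates_mono (p := p) (f := f) (I := I) (Finset.subset_insert t S) ψ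
  cases hg : greedyStep p f I tie (insert t S) ψ with
  | none =>
    rw [greedyStep_eq_none_iff] at hg
    exact ((greedyStep_eq_none_iff p f I tie).2 (Finset.subset_empty.1 (hg ▸ hsub))).symm
  | some e =>
    have hc := isGreedyChoice_of_greedyStep p f I tie hg
    have hne : e ≠ t := fun he => h (by rw [hg, he])
    refine ((greedyStep_eq_some_iff p f I tie).2 ⟨?_, fun e' he' => hc.2.1 e' (hsub he'),
      fun e' he' => hc.2.2 e' (hsub he')⟩).symm
    have h1 := hc.1
    simp only [candidates, Finset.mem_filter, Finset.mem_insert, hne, false_or] at h1 ⊢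
    exact h1

theorem greedyStep_ne_of_notMem_succ {S : Finset E} {t : E} {i : ℕ} {φ : E → O}
    (h : t ∉ stage p f I tie S (i + 1) φ) :
    greedyStep p f I tie S (restrict φ (stage p f I tie S i φ)) ≠ some t :=
  fun hg => h (by rw [stage_succ_of_some hg]; exact Finset.mem_insert_self _ _)

/-- As long as the additional item is not selected, the greedy runs coincide. -/
theorem stage_insert_of_notMem {S : Finset E} {t : E} {i : ℕ} {φ : E → O}
    (h : t ∉ stage p f I tie (insert t S) i φ) :
    stage p f I tie (insert t S) i φ = stage p f I tie S i φ := by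
  induction i with
  | zero => rfl
  | succ i ih =>
    have ih' := ih fun ht => h (stage_subset_succ _ i φ ht)
    have hne := greedyStep_ne_of_notMem_succ h
    rw [stage_succ, stage_succ, greedyNext, greedyNext, greedyStep_insert_of_ne hne, ih']

theorem exists_greedyStep_of_mem_stage {S : Finset E} {t : E} {n : ℕ} {φ : E → O}
    (h : t ∈ stage p f I tie S n φ) :
    ∃ i < n, t ∉ stage p f I tie S i φ ∧
      greedyStep p f I tie S (restrict φ (stage p f I tie S i φ)) = some t := by
  induction n with
  | zero => simp [stage_zero] at h
  | succ n ih =>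
    by_cases hn : t ∈ stage p f I tie S n φ
    · obtain ⟨i, hi, h'⟩ := ih hn
      exact ⟨i, hi.trans n.lt_succ_self, h'⟩
    · refine ⟨n, n.lt_succ_self, hn, ?_⟩
      cases hg : greedyStep p f I tie S (restrict φ (stage p f I tie S n φ)) with
      | none => rw [stage_succ_of_none hg] at h; exact absurd h hn
      | some e =>
        rw [stage_succ_of_some hg, Finset.mem_insert] at h
        rw [h.resolve_right hn]

variable (p f I tie) in
/-- The conditional expected marginal utility of `e` at the moment the greedy policy on `S`
selects it, and `0` if it does not. -/
def itemGain (S : Finset E) (e : E) (φ : E → O) : ℝ :=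
  ∑ i ∈ Finset.range (Fintype.card E),
    if greedyStep p f I tie S (restrict φ (stage p f I tie S i φ)) = some e then
      marginal p f e (restrict φ (stage p f I tie S i φ)) else 0

theorem marginal_pos_of_greedyStep {S D : Finset E} {e : E} {φ : E → O}
    (h : greedyStep p f I tie S (restrict φ D) = some e) :
    0 < marginal p f e (restrict φ D) :=
  ((mem_candidates_restrict p f I).1 (mem_candidates_of_greedyStep p f I tie h)).2.2.2

theorem itemGain_nonneg (S : Finset E) (e : E) (φ : E → O) : 0 ≤ itemGain p f I tie S e φ := by
  refine Finset.sum_nonneg fun i _ => ?_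
  split_ifs with h
  · exact (marginal_pos_of_greedyStep h).le
  · exact le_rfl

theorem marginal_le_itemGain {S : Finset E} {e : E} {φ : E → O} {i : ℕ}
    (hi : i < Fintype.card E)
    (h : greedyStep p f I tie S (restrict φ (stage p f I tie S i φ)) = some e) :
    marginal p f e (restrict φ (stage p f I tie S i φ)) ≤ itemGain p f I tie S e φ := by
  unfold itemGain
  refine le_trans (by rw [if_pos h]) (Finset.single_le_sum
    (f := fun i => if greedyStep p f I tie S (restrict φ (stage p f I tie S i φ)) = some e then
      marginal p f e (restrict φ (stage p f I tie S i φ)) else 0)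
    (fun i _ => ?_) (Finset.mem_range.2 hi))
  split_ifs with h
  · exact (marginal_pos_of_greedyStep h).le
  · exact le_rfl

theorem sum_itemGain (S : Finset E) (φ : E → O) :
    ∑ e ∈ S, itemGain p f I tie S e φ = gain p f I tie S φ := by
  unfold itemGain gain
  rw [Finset.sum_comm]
  refine Finset.sum_congr rfl fun i _ => ?_
  unfold stepGain
  cases hg : greedyStep p f I tie S (restrict φ (stage p f I tie S i φ)) with
  | none => simp
  | some e =>
    have heS := ((mem_candidates_restrict p f I).1 (mem_candidates_of_greedyStep p f I tie hg)).1
    simp [heS]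

/-- Averaged over all sets, the items sampled out lose as much as the sampled items gain. -/
theorem sum_compl_itemGain (φ : E → O) :
    ∑ S : Finset E, ∑ e ∈ Sᶜ, itemGain p f I tie (insert e S) e φ =
      ∑ S : Finset E, gain p f I tie S φ := by
  simp_rw [← sum_itemGain]
  rw [Finset.sum_sigma', Finset.sum_sigma']
  refine Finset.sum_bij' (fun x _ => ⟨insert x.2 x.1, x.2⟩) (fun x _ => ⟨x.1.erase x.2, x.2⟩)
    ?_ ?_ ?_ ?_ ?_
  · simp
  · simp
  · rintro ⟨S, e⟩ h
    have : e ∉ S := by simpa using h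
    simp [this]
  · rintro ⟨S, e⟩ h
    have : e ∈ S := by simpa using h
    simp [this]
  · simp

theorem stepGain_nonneg (S : Finset E) (i : ℕ) (φ : E → O) : 0 ≤ stepGain p f I tie S i φ := by
  unfold stepGain
  cases hg : greedyStep p f I tie S (restrict φ (stage p f I tie S i φ)) with
  | none => simp
  | some e => exact (marginal_pos_of_greedyStep hg).le

theorem marginal_le_stepGain {S : Finset E} {t : E} {i : ℕ} {φ : E → O}
    (h : t ∈ candidates p f I S (restrict φ (stage p f I tie S i φ))) :
    marginal p f t (restrict φ (stage p f I tie S i φ)) ≤ stepGain p f I tie S i φ := by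
  unfold stepGain
  cases hg : greedyStep p f I tie S (restrict φ (stage p f I tie S i φ)) with
  | none => rw [greedyStep_eq_none_iff] at hg; simp [hg] at h
  | some e => exact (isGreedyChoice_of_greedyStep p f I tie hg).2.1 t h

/-- The item chosen at step `i + 1` was already a candidate at step `i`, with at least the same
marginal: independence is closed under subsets and marginals decrease along the run. -/
theorem stepGain_antitone (hs : IsAdaptiveSubmodular p f) (hI : IsIndependenceSystem I)
    {φ : E → O} (hφ : φ ∈ p.support) (S : Finset E) :
    Antitone fun i => stepGain p f I tie S i φ := by
  refine antitone_nat_of_succ_le fun i => ?_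
  cases hg : greedyStep p f I tie S (restrict φ (stage p f I tie S (i + 1) φ)) with
  | none => rw [stepGain, hg]; exact stepGain_nonneg S i φ
  | some e =>
    have hc := (mem_candidates_restrict p f I).1 (mem_candidates_of_greedyStep p f I tie hg)
    have hsub := stage_subset_succ (p := p) (f := f) (I := I) (tie := tie) S i φ
    have hle := marginal_restrict_anti hs hφ hsub hc.2.1
    rw [stepGain, hg, Option.elim_some]
    refine hle.trans (marginal_le_stepGain ((mem_candidates_restrict p f I).2
      ⟨hc.1, fun h => hc.2.1 (hsub h), hI.2 _ hc.2.2.1 _ (Finset.insert_subset_insert e hsub),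
        hc.2.2.2.trans_le hle⟩))

/-- The items of an independent set `T` that the greedy policy on `S` leaves out have a total
marginal utility of at most `k` times the greedy gain, plus the gains of the items outside `S`
that the greedy policy would have selected had they been available. -/
theorem sum_marginal_le (hs : IsAdaptiveSubmodular p f) {k : ℕ} (hI : IsKSystem I k)
    {φ : E → O} (hφ : φ ∈ p.support) (S : Finset E) {T : Finset E} (hT : T ∈ I) :
    ∑ e ∈ T \ greedySet p f I tie S φ,
        marginal p f e (restrict φ (greedySet p f I tie S φ)) ≤
      k * gain p f I tie S φ + ∑ e ∈ Sᶜ, itemGain p f I tie (insert e S) e φ := by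
  classical
  set A := greedySet p f I tie S φ with hA
  -- `X` holds the items lost to sampling, which necessarily lie outside `S`; `Y` holds those
  -- rejected although available or made available, with positive marginal.
  set X := (T \ A).filter fun t => t ∈ greedySet p f I tie (insert t S) φ with hX
  set Z := (T \ A).filter fun t => t ∉ greedySet p f I tie (insert t S) φ with hZ
  set Y := Z.filter fun t => 0 < marginal p f t (restrict φ A) with hY
  have hXsum : ∑ t ∈ X, marginal p f t (restrict φ A) ≤
      ∑ e ∈ Sᶜ, itemGain p f I tie (insert e S) e φ := by
    have hXS : X ⊆ Sᶜ := by
      intro t ht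
      rw [hX, Finset.mem_filter, Finset.mem_sdiff] at ht
      rw [Finset.mem_compl]
      intro htS
      rw [Finset.insert_eq_of_mem htS] at ht
      exact ht.1.2 ht.2
    refine le_trans (Finset.sum_le_sum fun t ht => ?_)
      (Finset.sum_le_sum_of_subset_of_nonneg hXS fun e _ _ => itemGain_nonneg _ _ _)
    rw [hX, Finset.mem_filter, Finset.mem_sdiff] at ht
    obtain ⟨i, hi, hti, hg⟩ := exists_greedyStep_of_mem_stage ht.2
    refine le_trans ?_ (marginal_le_itemGain hi hg)
    rw [stage_insert_of_notMem hti]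
    exact marginal_restrict_anti hs hφ (stage_mono S φ hi.le) ht.1.2
  have hYmem : ∀ t ∈ Y, t ∈ T ∧ t ∉ A ∧ t ∉ greedySet p f I tie (insert t S) φ ∧
      0 < marginal p f t (restrict φ A) := by
    intro t ht
    simp only [hY, hZ, Finset.mem_filter, Finset.mem_sdiff] at ht
    tauto
  have hnot : ∀ t ∈ Y, ∀ i ≤ Fintype.card E, t ∉ stage p f I tie (insert t S) i φ :=
    fun t ht i hi hmem => (hYmem t ht).2.2.1 (stage_mono _ φ hi hmem)
  -- The run on `insert t S` also ends in `A`; if `t` still fitted, it would be a candidate of a run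
  -- that has stopped.
  have hinf : ∀ t ∈ Y, insert t A ∉ I := by
    intro t ht hmem
    obtain ⟨_, htA, htG, hpos⟩ := hYmem t ht
    have heq : greedySet p f I tie (insert t S) φ = A := stage_insert_of_notMem htG
    have hnone := greedyStep_greedySet (p := p) (f := f) (I := I) (tie := tie) (insert t S) φ
    rw [greedyStep_eq_none_iff, heq] at hnone
    have : t ∈ candidates p f I (insert t S) (restrict φ A) :=
      (mem_candidates_restrict p f I).2 ⟨Finset.mem_insert_self t S, htA, hmem, hpos⟩
    simp [hnone] at this
  -- While `t` fits, it competes in the run on `insert t S` and loses to the same item that the run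
  -- on `S` selects.
  have hcharge : ∀ t ∈ Y, ∀ i < Fintype.card E, insert t (stage p f I tie S i φ) ∈ I →
      marginal p f t (restrict φ A) ≤ stepGain p f I tie S i φ := by
    intro t ht i hi hmem
    obtain ⟨_, htA, _, hpos⟩ := hYmem t ht
    have heq := stage_insert_of_notMem (hnot t ht i hi.le)
    have hsub : stage p f I tie S i φ ⊆ A := stage_mono S φ hi.le
    have hle := marginal_restrict_anti hs hφ hsub htA
    have hstep := greedyStep_ne_of_notMem_succ (hnot t ht (i + 1) hi)
    have hgain : stepGain p f I tie (insert t S) i φ = stepGain p f I tie S i φ := by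
      rw [stepGain, stepGain, greedyStep_insert_of_ne hstep, heq]
    rw [← hgain]
    refine hle.trans (heq ▸ marginal_le_stepGain ?_)
    rw [heq]
    exact (mem_candidates_restrict p f I).2 ⟨Finset.mem_insert_self t S,
      fun h => htA (hsub h), hmem, hpos.trans_le hle⟩
  -- Step `j` is the one whose selection blocks `t`: `t` fits stage `j` but not stage `j + 1`. Hence
  -- `j t < i` means that `t` is blocked at stage `i`, as the count below requires.
  have hj : ∀ t ∈ Y, ∃ j, j < Fintype.card E ∧ insert t (stage p f I tie S j φ) ∈ I ∧
      insert t (stage p f I tie S (j + 1) φ) ∉ I := by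
    intro t ht
    by_contra! hcon
    have : ∀ i ≤ Fintype.card E, insert t (stage p f I tie S i φ) ∈ I := by
      intro i
      induction i with
      | zero =>
        intro _
        refine hI.1.2 T hT _ ?_
        simpa [stage_zero] using (hYmem t ht).1
      | succ i ih => exact fun hi => hcon i hi (ih (Nat.le_of_succ_le hi))
    exact hinf t ht (this _ le_rfl)
  choose! j hjlt hjI hjI' using hj
  have hcount : ∀ i, (Y.filter fun t => j t < i).card ≤ k * i := by
    intro i
    refine (hI.card_le (D := stage p f I tie S i φ) (stage_mem hI.1.1 S i φ)
      (hI.1.2 T hT _ fun t ht => (hYmem t (Finset.mem_filter.1 ht).1).1)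
      fun t ht _ hmem => ?_).trans (Nat.mul_le_mul_left k (card_stage_le S i φ))
    obtain ⟨htY, hti⟩ := Finset.mem_filter.1 ht
    exact hjI' t htY (hI.1.2 _ hmem _ (Finset.insert_subset_insert t (stage_mono S φ hti)))
  have hYsum : ∑ t ∈ Y, marginal p f t (restrict φ A) ≤ k * gain p f I tie S φ := by
    have h := sum_filter_add_le_mul_sum
      (stepGain_antitone (tie := tie) hs hI.1 hφ S) hcount (Fintype.card E)
    have hall : Y.filter (fun t => j t < Fintype.card E) = Y :=
      Finset.filter_true_of_mem hjlt
    have hcard : (Y.card : ℝ) ≤ k * Fintype.card E := by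
      have := hcount (Fintype.card E)
      rw [hall] at this
      exact_mod_cast this
    rw [hall] at h
    -- The unused-capacity term is non-negative and is dropped.
    have hnn := mul_nonneg (sub_nonneg.2 hcard) (stepGain_nonneg (p := p) (f := f) (I := I)
      (tie := tie) S (Fintype.card E) φ)
    have hle : ∑ t ∈ Y, marginal p f t (restrict φ A) ≤
        ∑ t ∈ Y, stepGain p f I tie S (j t) φ :=
      Finset.sum_le_sum fun t ht => hcharge t ht (j t) (hjlt t ht) (hjI t ht)
    unfold gain
    linarith
  have hZsum : ∑ t ∈ Z, marginal p f t (restrict φ A) ≤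
      ∑ t ∈ Y, marginal p f t (restrict φ A) := by
    refine le_of_le_of_eq (Finset.sum_le_sum fun t _ => ?_) (Finset.sum_filter _ _).symm
    split_ifs with h
    · exact le_rfl
    · exact not_lt.1 h
  rw [← Finset.sum_filter_add_sum_filter_not (T \ A)
    fun t => t ∈ greedySet p f I tie (insert t S) φ]
  linarith

end Charging

/-! ### Finite distributions -/

theorem sum_bind_mul {α β : Type*} [Fintype α] [Fintype β] (q : PMF α) (F : α → PMF β)
    (g : β → ℝ) :
    ∑ b, ((q.bind F) b).toReal * g b = ∑ a, (q a).toReal * ∑ b, (F a b).toReal * g b := by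
  simp_rw [PMF.bind_apply, tsum_fintype]
  simp_rw [ENNReal.toReal_sum fun a _ => ENNReal.mul_ne_top (PMF.apply_ne_top q a)
    (PMF.apply_ne_top (F a) _), ENNReal.toReal_mul, Finset.sum_mul, Finset.mul_sum, mul_assoc]
  exact Finset.sum_comm

theorem sum_pure_mul {β : Type*} [Fintype β] (b : β) (g : β → ℝ) :
    ∑ b', (PMF.pure b b').toReal * g b' = g b := by
  classical
  simp only [PMF.pure_apply]
  rw [Finset.sum_eq_single b] <;> simp +contextual

theorem toReal_coin_half (h : (1 / 2 : ℝ≥0) ≤ 1) (b : Bool) :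
    (coin (1 / 2) h b).toReal = 1 / 2 := by
  cases b <;> simp [coin, PMF.ofFintype_apply]

theorem toReal_randomSubset_half [Fintype E] (h : (1 / 2 : ℝ≥0) ≤ 1) (S : Finset E) :
    (randomSubset E (1 / 2) h S).toReal = (1 / 2) ^ Fintype.card E := by
  have hh : (1 - 1 / 2 : ℝ≥0) = 1 / 2 := tsub_eq_of_eq_add (by norm_num)
  rw [randomSubset, PMF.ofFintype_apply, hh, ← pow_add, Nat.add_sub_cancel' S.card_le_univ,
    ENNReal.coe_toReal]
  simp

/-! ### Comparison with a feasible policy -/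

section Comparison

variable [Fintype E] [DecidableEq E] {p : PMF (E → O)} {f : Finset E → (E → O) → ℝ}
  {I : Set (Finset E)} {tie : PartialRealization E O → (E ↪ ℕ)}

theorem hasExpect_itemGain (hf : ∀ S, HasExpect p (f S)) {S : Finset E} {e : E} (he : e ∈ S) :
    HasExpect p (itemGain p f I tie S e) := by
  refine Summable.of_nonneg_of_le
    (fun φ => mul_nonneg ENNReal.toReal_nonneg (itemGain_nonneg S e φ))
    (fun φ => mul_le_mul_of_nonneg_left ?_ ENNReal.toReal_nonneg)
    (hasExpect_gain (I := I) (tie := tie) hf S)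
  rw [← sum_itemGain]
  exact Finset.single_le_sum (f := fun e => itemGain p f I tie S e φ)
    (fun e _ => itemGain_nonneg S e φ) he

/-- The pointwise charging bound does not depend on `T`, so averaging over the law of `π` leaves it
unchanged; feasibility makes it applicable to every `T` of positive probability. -/
theorem Policy.expect_union_greedySet_le (hf : ∀ S, HasExpect p (f S))
    (hs : IsAdaptiveSubmodular p f) {k : ℕ} (hI : IsKSystem I k) (π : Policy E O)
    (hπ : ∀ φ ∈ p.support, ∀ T ∈ (π.selected φ).support, T ∈ I) (S : Finset E) :
    expect p (fun φ => ∑ T, π.law φ T * f (T ∪ greedySet p f I tie S φ) φ) ≤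
      expect p (fun φ => f (greedySet p f I tie S φ) φ) + (k * expect p (gain p f I tie S) +
        expect p (fun φ => ∑ e ∈ Sᶜ, itemGain p f I tie (insert e S) e φ)) := by
  have hg : HasExpect p fun φ => k * gain p f I tie S φ := (hasExpect_gain hf S).const_mul k
  have hl : HasExpect p fun φ => ∑ e ∈ Sᶜ, itemGain p f I tie (insert e S) e φ :=
    HasExpect.sum fun e _ => hasExpect_itemGain hf (Finset.mem_insert_self e S)
  refine (π.expect_union_le hf hs (isAdapted_greedySet S)).trans (add_le_add_right ?_ _)
  rw [← expect_const_mul, ← expect_add hg hl]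
  refine expect_mono (HasExpect.sum_law (fun T => HasExpect.comp (fun B =>
    HasExpect.sum fun e _ => hasExpect_marginal hf e B) (greedySet p f I tie S)) π)
    (hg.add hl) fun φ hφ => ?_
  calc _ ≤ ∑ T, π.law φ T * (k * gain p f I tie S φ +
        ∑ e ∈ Sᶜ, itemGain p f I tie (insert e S) e φ) := by
        refine Finset.sum_le_sum fun T _ => ?_
        by_cases hT : π.selected φ T = 0
        · simp [Policy.law, hT]
        · exact mul_le_mul_of_nonneg_left (sum_marginal_le hs hI hφ S (hπ φ hφ T hT))
            (π.law_nonneg φ T)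
    _ = _ := by rw [← Finset.sum_mul, π.sum_law, one_mul]

theorem Policy.pow_card_mul_expect_le (hf : ∀ S, HasExpect p (f S)) (h0 : ∀ S φ, 0 ≤ f S φ)
    (hs : IsAdaptiveSubmodular p f) {k : ℕ} (hI : IsKSystem I k) (π : Policy E O)
    (hπ : ∀ φ ∈ p.support, ∀ T ∈ (π.selected φ).support, T ∈ I) :
    2 ^ Fintype.card E * expect p (fun φ => ∑ T, π.law φ T * f T φ) ≤
      (2 * k + 4) * ∑ S, expect p (fun φ => f (greedySet p f I tie S φ) φ) := by
  set U : Finset E → ℝ := fun S =>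
    expect p (fun φ => ∑ T, π.law φ T * f (T ∪ greedySet p f I tie S φ) φ) with hU
  have hlow : 2 ^ Fintype.card E * expect p (fun φ => ∑ T, π.law φ T * f T φ) ≤
      2 * ∑ S, U S := by
    calc _ = ∑ _S : Finset E, expect p (fun φ => ∑ T, π.law φ T * f T φ) := by simp
      _ ≤ ∑ S, (U S + U Sᶜ) := Finset.sum_le_sum fun S _ =>
          π.expect_le_union_add_union hf h0 hs (isAdapted_greedySet Sᶜ)
            fun φ => Finset.disjoint_left.2 fun e he =>
              Finset.mem_compl.1 (stage_subset Sᶜ _ φ he)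
      _ = 2 * ∑ S, U S := by
          rw [Finset.sum_add_distrib, Fintype.sum_bijective compl compl_bijective
            (fun S => U Sᶜ) U fun _ => rfl, two_mul]
  have hg : ∑ S, expect p (gain p f I tie S) ≤
      ∑ S, expect p (fun φ => f (greedySet p f I tie S φ) φ) :=
    Finset.sum_le_sum fun S _ => expect_gain_le hf h0 S
  have hswap : ∑ S, expect p (fun φ => ∑ e ∈ Sᶜ, itemGain p f I tie (insert e S) e φ) =
      ∑ S, expect p (gain p f I tie S) := by
    rw [← expect_sum fun S _ => HasExpect.sum fun e _ =>
      hasExpect_itemGain hf (Finset.mem_insert_self e S),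
      ← expect_sum fun S _ => hasExpect_gain hf S]
    simp_rw [sum_compl_itemGain]
  have hup : ∑ S, U S ≤ ∑ S, expect p (fun φ => f (greedySet p f I tie S φ) φ) +
      (k * ∑ S, expect p (gain p f I tie S) + ∑ S, expect p (gain p f I tie S)) := by
    refine (Finset.sum_le_sum fun S _ =>
      π.expect_union_greedySet_le (tie := tie) hf hs hI hπ S).trans_eq ?_
    rw [Finset.sum_add_distrib, Finset.sum_add_distrib, hswap, Finset.mul_sum]
  have hk := mul_le_mul_of_nonneg_left hg (Nat.cast_nonneg (α := ℝ) k)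
  linarith

/-! ### Randomized policies -/

/-- Averaging over the drawn policy is an exchange of sums of non-negative terms; in `ℝ≥0∞` it needs
no summability over policies. -/
theorem favg_le_of_forall_support (hf : ∀ S, HasExpect p (f S)) (h0 : ∀ S φ, 0 ≤ f S φ)
    (π : RandomizedPolicy E O) {C : ℝ} (hC : 0 ≤ C)
    (h : ∀ π' ∈ π.support, expect p (fun φ => ∑ T, π'.law φ T * f T φ) ≤ C) :
    favg p f π ≤ C := by
  have hsingle : ∀ π' ∈ π.support,
      ∑' φ, p φ * ∑ T, π'.selected φ T * ENNReal.ofReal (f T φ) ≤ ENNReal.ofReal C := by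
    intro π' hπ'
    refine le_trans (le_of_eq ?_) (ENNReal.ofReal_le_ofReal (h π' hπ'))
    rw [expect, ENNReal.ofReal_tsum_of_nonneg]
    · refine tsum_congr fun φ => ?_
      rw [ENNReal.ofReal_mul ENNReal.toReal_nonneg, ENNReal.ofReal_toReal (p.apply_ne_top φ),
        ENNReal.ofReal_sum_of_nonneg fun T _ => mul_nonneg (π'.law_nonneg φ T) (h0 T φ)]
      congr 1
      refine Finset.sum_congr rfl fun T _ => ?_
      rw [ENNReal.ofReal_mul (π'.law_nonneg φ T), Policy.law,
        ENNReal.ofReal_toReal (PMF.apply_ne_top _ T)]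
    · exact fun φ => mul_nonneg ENNReal.toReal_nonneg
        (Finset.sum_nonneg fun T _ => mul_nonneg (π'.law_nonneg φ T) (h0 T φ))
    · exact HasExpect.sum_law hf π'
  have htotal : ∑' φ, p φ * ∑ T, selected π φ T * ENNReal.ofReal (f T φ) ≤ ENNReal.ofReal C := by
    have hswap : ∑' φ, p φ * ∑ T, selected π φ T * ENNReal.ofReal (f T φ) =
        ∑' π', π π' * ∑' φ, p φ * ∑ T, π'.selected φ T * ENNReal.ofReal (f T φ) := by
      simp_rw [← ENNReal.tsum_mul_left]
      rw [ENNReal.tsum_comm]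
      refine tsum_congr fun φ => ?_
      simp_rw [selected, PMF.bind_apply, ← ENNReal.tsum_mul_right]
      rw [← Summable.tsum_finsetSum fun _ _ => ENNReal.summable, ← ENNReal.tsum_mul_left]
      refine tsum_congr fun π' => ?_
      simp_rw [Finset.mul_sum]
      refine Finset.sum_congr rfl fun T _ => ?_
      ring
    rw [hswap]
    calc _ ≤ ∑' π', π π' * ENNReal.ofReal C := by
          refine ENNReal.tsum_le_tsum fun π' => ?_
          by_cases hπ' : π π' = 0
          · simp [hπ']
          · exact mul_le_mul_right (hsingle π' hπ') _
      _ = ENNReal.ofReal C := by rw [ENNReal.tsum_mul_right, π.tsum_coe, one_mul]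
  have hfavg : favg p f π =
      (∑' φ, p φ * ∑ T, selected π φ T * ENNReal.ofReal (f T φ)).toReal := by
    have hfin : ∀ φ T, selected π φ T * ENNReal.ofReal (f T φ) ≠ ⊤ :=
      fun φ T => ENNReal.mul_ne_top (PMF.apply_ne_top _ T) ENNReal.ofReal_ne_top
    rw [ENNReal.tsum_toReal_eq fun φ => ENNReal.mul_ne_top (p.apply_ne_top φ)
      (ENNReal.sum_ne_top.2 fun T _ => hfin φ T)]
    simp_rw [favg, ENNReal.toReal_mul, ENNReal.toReal_sum fun T _ => hfin _ T,
      ENNReal.toReal_mul, ENNReal.toReal_ofReal (h0 _ _)]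
  rw [hfavg]
  exact ENNReal.toReal_le_of_le_ofReal hC htotal

/-! ### The sampling-based policy -/

theorem selected_sag (δ₀ δ₁ : ℝ≥0) (h₀ : δ₀ ≤ 1) (h₁ : δ₁ ≤ 1) (φ : E → O) :
    selected (sag p f I tie δ₀ δ₁ h₀ h₁) φ =
      (coin δ₁ h₁).bind fun b => (randomSubset E δ₀ h₀).bind fun S =>
        PMF.pure (greedySet p f I tie (if b then S else Sᶜ) φ) := by
  simp only [selected, sag, PMF.bind_bind, PMF.pure_bind, greedyPolicy_selected]

theorem feasible_sag (hI : ∅ ∈ I) (δ₀ δ₁ : ℝ≥0) (h₀ : δ₀ ≤ 1) (h₁ : δ₁ ≤ 1) :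
    Feasible p I (sag p f I tie δ₀ δ₁ h₀ h₁) := by
  intro φ _ T hT
  rw [selected_sag] at hT
  simp only [PMF.mem_support_bind_iff, PMF.mem_support_pure_iff] at hT
  obtain ⟨b, _, S, _, rfl⟩ := hT
  exact stage_mem hI _ _ φ

/-- A fair sample and its complement are both uniform over the subsets of `E`, so the outcome of the
coin does not affect the average. -/
theorem favg_sag_half (hf : ∀ S, HasExpect p (f S)) (h₀ h₁ : (1 / 2 : ℝ≥0) ≤ 1) :
    favg p f (sag p f I tie (1 / 2) (1 / 2) h₀ h₁) =
      (1 / 2) ^ Fintype.card E *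
        ∑ S, expect p (fun φ => f (greedySet p f I tie S φ) φ) := by
  have hφ : ∀ φ, ∑ T, (selected (sag p f I tie (1 / 2) (1 / 2) h₀ h₁) φ T).toReal * f T φ =
      (1 / 2) ^ Fintype.card E * ∑ S, f (greedySet p f I tie S φ) φ := by
    intro φ
    rw [selected_sag, sum_bind_mul]
    simp_rw [sum_bind_mul, sum_pure_mul, toReal_coin_half, toReal_randomSubset_half,
      ← Finset.mul_sum]
    have hc : ∑ S : Finset E, f (greedySet p f I tie Sᶜ φ) φ =
        ∑ S, f (greedySet p f I tie S φ) φ :=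
      Fintype.sum_bijective compl compl_bijective _ _ fun _ => rfl
    simp only [Fintype.sum_bool, if_true, Bool.false_eq_true, if_false, hc]
    ring
  simp only [favg, hφ]
  change expect p (fun φ => _ * ∑ S, f (greedySet p f I tie S φ) φ) = _
  rw [expect_const_mul, expect_sum fun S _ => HasExpect.comp hf _]

end Comparison

end AdaptiveSubmodular

end

/-! ### The approximation guarantee -/

theorem mainTheorem2 {E : Type*} {O : Type*} [Fintype E] [DecidableEq E]
    (p : PMF (E → O)) (f : Finset E → (E → O) → ℝ)
    (hf_nonneg : ∀ S φ, 0 ≤ f S φ)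
    (hf_int : ∀ S, Summable fun φ => (p φ).toReal * f S φ)
    (hf : AdaptiveSubmodular.IsAdaptiveSubmodular p f)
    (I : Set (Finset E)) (k : ℕ) (hI : AdaptiveSubmodular.IsKSystem I k)
    (tie : AdaptiveSubmodular.PartialRealization E O → (E ↪ ℕ))
    (δ₀ δ₁ : NNReal) (h₀ : δ₀ ≤ 1) (h₁ : δ₁ ≤ 1) (hδ₀ : δ₀ = 1 / 2) (hδ₁ : δ₁ = 1 / 2) :
    AdaptiveSubmodular.Feasible p I (AdaptiveSubmodular.sag p f I tie δ₀ δ₁ h₀ h₁) ∧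
    ∀ πopt : AdaptiveSubmodular.RandomizedPolicy E O, AdaptiveSubmodular.Feasible p I πopt →
      1 / (2 * (k : ℝ) + 4) * AdaptiveSubmodular.favg p f πopt ≤
        AdaptiveSubmodular.favg p f (AdaptiveSubmodular.sag p f I tie δ₀ δ₁ h₀ h₁) := by
  subst hδ₀ hδ₁
  refine ⟨AdaptiveSubmodular.feasible_sag hI.1.1 _ _ _ _, fun πopt hopt => ?_⟩
  have hk : (0 : ℝ) < 2 * (k : ℝ) + 4 := by positivity
  rw [one_div, inv_mul_le_iff₀ hk, AdaptiveSubmodular.favg_sag_half hf_int]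
  have hsum : 0 ≤ ∑ S, AdaptiveSubmodular.expect p
      (fun φ => f (AdaptiveSubmodular.greedySet p f I tie S φ) φ) :=
    Finset.sum_nonneg fun S _ => AdaptiveSubmodular.expect_nonneg fun φ => hf_nonneg _ _
  -- Each policy in the support of a feasible randomized policy is itself feasible.
  refine AdaptiveSubmodular.favg_le_of_forall_support hf_int hf_nonneg πopt
    (mul_nonneg hk.le (mul_nonneg (by positivity) hsum)) fun π hπ => ?_
  have h := π.pow_card_mul_expect_le (tie := tie) hf_int hf_nonneg hf hI
    fun φ hφ T hT => hopt φ hφ T ((PMF.mem_support_bind_iff _ _ _).2 ⟨π, hπ, hT⟩)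
  rw [mul_left_comm, one_div, inv_pow, inv_mul_eq_div, le_div_iff₀' (by positivity)]
  exact h
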